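/- Let $b\ge 1$ be an integer, $r=\frac{b}{2b+1}$. The bubble-diamond graphs $G_\ell=(V_\ell,E_\ell)$ are defined as follows: $G_0$ has two vertices $q_1,q_2$ joined by one edge, and $G_{\ell+1}$ arises from $G_\ell$ by replacing each edge $\{p,q\}$ by two new vertices $p',q'$, one edge $\{p,p'\}$, one edge $\{q',q\}$ and $b$ parallel edges $\{p',q'\}$. Let $V_*=\bigcup_\ell V_\ell$, and let $F_1,\dots,F_{b+2}:V_*\to V_*$ be the maps onto the $b+2$ copies of the construction: $F_{b+1}$ is the copy along the edge at $q_1$ (it fixes $q_1$), $F_{b+2}$ the copy along the edge at $q_2$ (it fixes $q_2$), and $F_1,\dots,F_b$ are the middle copies. For $f:V_*\to\mathbb R$ put $\mathcal E_\ell(f)=r^{-\ell}\sum_{\{p,q\}\in E_\ell}|f(p)-f(q)|^2$ and $\mathcal E(f)=\lim_\ell\mathcal E_\ell(f)$, with the bilinear form $\mathcal E(f,g)$ given by polarization; $\operatorname{dom}\mathcal E=\{\mathcal E<\infty\}$. The fractal $K_b$ is the completion of $V_*$ in the resistance metric $R(p,q)=\min\{R\ge 0:|f(p)-f(q)|^2\le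 R\,\mathcal E(f)\ \forall f\in\operatorname{dom}\mathcal E\}$; functions in $\operatorname{dom}\mathcal E$ and the maps $F_i$ are extended continuously to $K_b$. Let $\mu$ be the self-similar Borel probability measure, $\mu(A)=\frac1{b+2}\sum_i\mu(F_i^{-1}A)$. For $u\in\operatorname{dom}\mathcal E$ and $f$ continuous on $K_b$, $\Delta u=f$ means $\mathcal E(u,g)=-\int_{K_b}fg\,d\mu$ for all $g\in\operatorname{dom}\mathcal E$ with $g(q_1)=g(q_2)=0$. The normal derivatives are $\partial_n u(q_1)=\lim_m r^{-m}(u(q_1)-u(F_{b+1}^m q_2))$ and $\partial_n u(q_2)=\lim_m r^{-m}(u(q_2)-u(F_{b+2}^m q_1))$. Put $\mathcal H_j=\{f:\Delta^{j+1}f=0\}$. For $j\ge 0$ and $k\in\{1,2\}$ let $f_{jk}\in\mathcal H_j$ be the function with $\Delta^m f_{jk}(q_n)=\delta_{jm}\delta_{kn}$ for $0\le m\le j$ and $n=1,2$, and let $P_{jk}\in\mathcal H_j$ be the monomial with $\Delta^mP_{jk}(q_1)=\delta_{mj}\delta_{k1}$ and $\partial_n\Delta^mP_{jk}(q_1)=\delta_{mj}\delta_{k2}$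 for $0\le m\le j$. Let $a_\ell=\int_{K_b} f_{\ell k}f_{0k}\,d\mu$ and $b_\ell=\int_{K_b} f_{\ell k}f_{0n}\,d\mu$ with $k\ne n$ (the recursions below hold for either choice of $k$, $n$), and put $a_{-1}=1$. Let $$\alpha_j=P_{j1}(q_2),\quad \beta_j=P_{j2}(q_2),\quad \eta_j=\partial_nP_{j1}(q_2),\quad \gamma_j=\partial_nP_{j2}(q_2).$$ **Theorem.** The functions $f_{jk}$ and $P_{jk}$ exist and are unique, the normal derivatives $\eta_j,\gamma_j$ exist, and $$\alpha_0=1,\quad \alpha_1=\tfrac12,\quad \beta_0=-1,\quad \eta_0=0,\quad \gamma_0=-1.$$ For $j\ge 2$, $$\alpha_j=\zeta_j\sum_{\ell=1}^{j-1}\alpha_{j-\ell}\Bigl(2\alpha_\ell+\sum_{\ell'=1}^{\ell}\alpha_{\ell-\ell'}\alpha_{\ell'}\Bigr),$$ and for $j\ge 1$, $$\beta_j=\iota_j\sum_{\ell=0}^{j-1}\sum_{\ell'=0}^{j-\ell}\beta_\ell\,\alpha_{\ell'}\alpha_{j-\ell-\ell'},\qquad \eta_j=b_{j-1}+\sum_{\ell=0}^{j}\alpha_{j-\ell}\,a_{\ell-1},\qquad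 \gamma_j=\sum_{\ell=0}^{j}\beta_{j-\ell}\,a_{\ell-1},$$ where $$\zeta_j=\frac{(b+1)^2}{(b+2)(2b+1)\left(\frac{(b+2)^{j-1}(2b+1)^{j-1}}{b^{j-1}}-1\right)},\qquad \iota_j=\frac{(b+1)^2}{(2b+1)\left(\frac{(b+2)^{j}(2b+1)^{j}}{b^{j}}-1\right)}.$$ -/

import Mathlib

namespace BubbleDiamond

open Filter Topology MeasureTheory

/-- Labels of the `b + 2` first-level cells. `Sum.inl i` are the `b` parallel middle cells, and
`Sum.inr 0`, `Sum.inr 1` are the end cells, at `q₁` and at `q₂` (usually numbered `b + 1` and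
`b + 2`). Words of length `l` in these labels index the edges (with multiplicity) of the `l`-th
bubble-diamond graph, and also the cells of level `l`. -/
abbrev Cell (b : ℕ) : Type := Fin b ⊕ Fin 2

/-- The vertices of all bubble-diamond graphs together. `bdry 0` is `q₁` and `bdry 1` is `q₂`;
`inner w 0` and `inner w 1` are the two new vertices that are introduced when the edge with
word `w` is refined, the first next to the initial and the second next to the final end of it. -/
inductive Vert (b : ℕ) : Type
  | bdry (k : Fin 2) : Vert b
  | inner (w : List (Cell b)) (k : Fin 2) : Vert b

/-- The map `F_i`, which places the graphs into their `i`-th copy in the next graph: a middle copy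
joins the two first-level vertices, the end copies join `q₁` to the first of them and the second of
them to `q₂`. -/
def cellMap {b : ℕ} : Cell b → Vert b → Vert b
  | Sum.inl _, Vert.bdry k => Vert.inner [] k
  | Sum.inr m, Vert.bdry k => if k = m then Vert.bdry k else Vert.inner [] m
  | i, Vert.inner w k => Vert.inner (i :: w) k

/-- `F_w = F_{w₁} ∘ ⋯ ∘ F_{w_l}`. The edge with word `w` joins `F_w q₁` and `F_w q₂`. -/
def wordMap {b : ℕ} : List (Cell b) → Vert b → Vert b
  | [], p => p
  | i :: w, p => cellMap i (wordMap w p)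

/-- The renormalization constant `r = b / (2b + 1)`. -/
noncomputable def ren (b : ℕ) : ℝ := (b : ℝ) / (2 * b + 1)

/-- The graph energy `r^{-l} ∑ |f p - f q|²`, summed over the edges of the `l`-th graph. -/
noncomputable def graphEnergy {b : ℕ} (l : ℕ) (f : Vert b → ℝ) : ℝ :=
  ((ren b) ^ l)⁻¹ * ∑ w : Fin l → Cell b,
    (f (wordMap (List.ofFn w) (Vert.bdry 0)) - f (wordMap (List.ofFn w) (Vert.bdry 1))) ^ 2

/-- `f ∈ dom 𝓔` (the graph energies are nondecreasing, see `graphEnergy_mono`). -/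
def FiniteEnergy {b : ℕ} (f : Vert b → ℝ) : Prop :=
  BddAbove (Set.range fun l : ℕ => graphEnergy l f)

/-- The energy `𝓔(f)`, which for `f ∈ dom 𝓔` is the limit of the graph energies, see
`FiniteEnergy.tendsto`. -/
noncomputable def energy {b : ℕ} (f : Vert b → ℝ) : ℝ := ⨆ l : ℕ, graphEnergy l f

/-- `R` is admissible in the definition of the resistance between `p` and `q`. -/
def ResistanceBound {b : ℕ} (p q : Vert b) (R : ℝ) : Prop :=
  0 ≤ R ∧ ∀ f : Vert b → ℝ, FiniteEnergy f → (f p - f q) ^ 2 ≤ R * energy f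

/-- The resistance metric: the least `R ≥ 0` with `|f p - f q|² ≤ R 𝓔(f)` for all `f ∈ dom 𝓔`
(the infimum is attained, see `resistanceBound_resistance`). -/
noncomputable def resistance {b : ℕ} (p q : Vert b) : ℝ :=
  sInf {R : ℝ | ResistanceBound p q R}

theorem ren_pos (b : ℕ) [NeZero b] : 0 < ren b := by
  have : (0 : ℝ) < b := by exact_mod_cast Nat.pos_of_ne_zero (NeZero.ne b)
  unfold ren; positivity

theorem wordMap_inner {b : ℕ} (w v : List (Cell b)) (k : Fin 2) :
    wordMap w (Vert.inner v k) = Vert.inner (w ++ v) k := by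
  induction w with
  | nil => rfl
  | cons i w ih => cases i <;> simp [wordMap, ih, cellMap]

theorem wordMap_append {b : ℕ} (v w : List (Cell b)) (p : Vert b) :
    wordMap (v ++ w) p = wordMap v (wordMap w p) := by
  induction v with
  | nil => rfl
  | cons i v ih => simp [wordMap, ih]

/-- Refining the edge with word `w` introduces the vertices `inner w 0` and `inner w 1`; its end
edges keep its end points, and its `b` middle edges join the two new vertices. -/
theorem wordMap_append_singleton {b : ℕ} (w : List (Cell b)) (i : Fin b) :
    wordMap (w ++ [Sum.inr 0]) (Vert.bdry 0) = wordMap w (Vert.bdry 0) ∧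
    wordMap (w ++ [Sum.inr 0]) (Vert.bdry 1) = Vert.inner w 0 ∧
    wordMap (w ++ [Sum.inl i]) (Vert.bdry 0) = Vert.inner w 0 ∧
    wordMap (w ++ [Sum.inl i]) (Vert.bdry 1) = Vert.inner w 1 ∧
    wordMap (w ++ [Sum.inr 1]) (Vert.bdry 0) = Vert.inner w 1 ∧
    wordMap (w ++ [Sum.inr 1]) (Vert.bdry 1) = wordMap w (Vert.bdry 1) := by
  simp [wordMap_append, wordMap, cellMap, wordMap_inner]

theorem graphEnergy_zero {b : ℕ} (f : Vert b → ℝ) :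
    graphEnergy 0 f = (f (Vert.bdry 0) - f (Vert.bdry 1)) ^ 2 := by
  simp [graphEnergy, wordMap]

theorem graphEnergy_succ {b : ℕ} (l : ℕ) (f : Vert b → ℝ) :
    graphEnergy (l + 1) f = (ren b)⁻¹ * ∑ i : Cell b, graphEnergy l (f ∘ cellMap i) := by
  unfold graphEnergy
  rw [← Finset.mul_sum, ← mul_assoc, pow_succ', mul_inv]
  congr 1
  rw [← (Fin.consEquiv fun _ : Fin (l + 1) => Cell b).sum_comp, Fintype.sum_prod_type]
  refine Finset.sum_congr rfl fun i _ => Finset.sum_congr rfl fun w _ => ?_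
  simp [Fin.consEquiv, List.ofFn_succ, wordMap]

theorem graphEnergy_nonneg {b : ℕ} (l : ℕ) (f : Vert b → ℝ) : 0 ≤ graphEnergy l f := by
  unfold graphEnergy ren
  positivity

theorem graphEnergy_mono {b : ℕ} [NeZero b] (f : Vert b → ℝ) :
    Monotone fun l : ℕ => graphEnergy l f := by
  refine monotone_nat_of_le_succ fun l => ?_
  have hr := ren_pos b
  induction l generalizing f with
  | zero =>
    have hb : (0 : ℝ) < b := by exact_mod_cast Nat.pos_of_ne_zero (NeZero.ne b)
    rw [graphEnergy_succ]
    simp only [graphEnergy_zero, Function.comp, Fintype.sum_sum_type, cellMap, Fin.sum_univ_two,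
      Finset.sum_const, Finset.card_univ, Fintype.card_fin, nsmul_eq_mul]
    simp only [if_true, if_false, zero_ne_one, one_ne_zero]
    generalize f (Vert.bdry 0) = x
    generalize f (Vert.bdry 1) = y
    generalize f (Vert.inner [] 0) = u
    generalize f (Vert.inner [] 1) = v
    rw [inv_mul_eq_div, le_div_iff₀ hr, ren, mul_div_assoc', div_le_iff₀ (by positivity)]
    nlinarith [sq_nonneg (x - u - (v - y)), mul_nonneg hb.le (sq_nonneg (x - u - (v - y))),
      sq_nonneg ((x - u) - b * (u - v)), sq_nonneg ((v - y) - b * (u - v))]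
  | succ l ih =>
    rw [graphEnergy_succ, graphEnergy_succ (l + 1)]
    exact mul_le_mul_of_nonneg_left (Finset.sum_le_sum fun i _ => ih _) (inv_nonneg.2 hr.le)

theorem FiniteEnergy.tendsto {b : ℕ} [NeZero b] {f : Vert b → ℝ} (hf : FiniteEnergy f) :
    Tendsto (fun l : ℕ => graphEnergy l f) atTop (𝓝 (energy f)) :=
  tendsto_atTop_ciSup (graphEnergy_mono f) hf

theorem FiniteEnergy.graphEnergy_le {b : ℕ} {f : Vert b → ℝ} (hf : FiniteEnergy f) (l : ℕ) :
    graphEnergy l f ≤ energy f := le_ciSup hf l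

theorem FiniteEnergy.of_le {b : ℕ} {f : Vert b → ℝ} {C : ℝ} (h : ∀ l, graphEnergy l f ≤ C) :
    FiniteEnergy f ∧ energy f ≤ C :=
  ⟨⟨C, by rintro _ ⟨l, rfl⟩; exact h l⟩, ciSup_le h⟩

theorem FiniteEnergy.energy_nonneg {b : ℕ} {f : Vert b → ℝ} (hf : FiniteEnergy f) :
    0 ≤ energy f := (graphEnergy_nonneg 0 f).trans (hf.graphEnergy_le 0)

theorem FiniteEnergy.comp_cellMap {b : ℕ} [NeZero b] {f : Vert b → ℝ} (hf : FiniteEnergy f)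
    (i : Cell b) :
    FiniteEnergy (f ∘ cellMap i) ∧ energy (f ∘ cellMap i) ≤ ren b * energy f := by
  refine FiniteEnergy.of_le fun l => ?_
  have h1 := hf.graphEnergy_le (l + 1)
  rw [graphEnergy_succ, inv_mul_le_iff₀ (ren_pos b)] at h1
  exact (Finset.single_le_sum (f := fun i => graphEnergy l (f ∘ cellMap i))
    (fun i _ => graphEnergy_nonneg _ _) (Finset.mem_univ i)).trans h1

theorem FiniteEnergy.split {b : ℕ} [NeZero b] {f : Vert b → ℝ} (hf : FiniteEnergy f) (t : ℝ) :
    FiniteEnergy (fun p => max (f p) t) ∧ FiniteEnergy (fun p => min (f p) t) ∧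
      energy (fun p => max (f p) t) + energy (fun p => min (f p) t) ≤ energy f := by
  have key : ∀ l, graphEnergy l (fun p => max (f p) t) + graphEnergy l (fun p => min (f p) t)
      ≤ graphEnergy l f := by
    intro l
    unfold graphEnergy
    rw [← mul_add, ← Finset.sum_add_distrib]
    beta_reduce
    refine mul_le_mul_of_nonneg_left (Finset.sum_le_sum fun w _ => ?_)
      (inv_nonneg.2 (pow_nonneg (ren_pos b).le _))
    generalize f (wordMap (List.ofFn w) (Vert.bdry 0)) = x
    generalize f (wordMap (List.ofFn w) (Vert.bdry 1)) = y
    rcases le_total x t with h1 | h1 <;> rcases le_total y t with h2 | h2 <;>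
      simp only [max_eq_left, max_eq_right, min_eq_left, min_eq_right, h1, h2] <;>
      nlinarith [mul_nonneg (sub_nonneg.2 h1) (sub_nonneg.2 h2)]
  have hM : FiniteEnergy (fun p => max (f p) t) := (FiniteEnergy.of_le (C := energy f) fun l => by
    linarith [key l, hf.graphEnergy_le l, graphEnergy_nonneg l (fun p => min (f p) t)]).1
  have hm : FiniteEnergy (fun p => min (f p) t) := (FiniteEnergy.of_le (C := energy f) fun l => by
    linarith [key l, hf.graphEnergy_le l, graphEnergy_nonneg l (fun p => max (f p) t)]).1
  exact ⟨hM, hm, le_of_tendsto_of_tendsto' (hM.tendsto.add hm.tendsto) hf.tendsto key⟩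

theorem ResistanceBound.symm {b : ℕ} {p q : Vert b} {R : ℝ} (h : ResistanceBound p q R) :
    ResistanceBound q p R := ⟨h.1, fun f hf => by have := h.2 f hf; nlinarith⟩

theorem ResistanceBound.trans {b : ℕ} [NeZero b] {p q z : Vert b} {R S : ℝ}
    (h1 : ResistanceBound p q R) (h2 : ResistanceBound q z S) : ResistanceBound p z (R + S) := by
  refine ⟨add_nonneg h1.1 h2.1, ?_⟩
  have main : ∀ {p q z : Vert b} {R S : ℝ}, ResistanceBound p q R → ResistanceBound q z S →
      ∀ f : Vert b → ℝ, FiniteEnergy f → f z ≤ f p → (f p - f z) ^ 2 ≤ (R + S) * energy f := by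
    intro p q z R S h1 h2 f hf hle
    have hE := hf.energy_nonneg
    have a1 := h1.2 f hf
    have a2 := h2.2 f hf
    have b1 := mul_nonneg h1.1 hE
    have b2 := mul_nonneg h2.1 hE
    rcases le_total (f q) (f z) with h | h
    · nlinarith
    rcases le_total (f p) (f q) with h' | h'
    · nlinarith
    obtain ⟨hM, hm, hs⟩ := hf.split (f q)
    have c1 := h1.2 _ hM
    have c2 := h2.2 _ hm
    simp only [max_eq_left h', max_self, min_self, min_eq_left h] at c1 c2
    have e1 := hM.energy_nonneg
    have e2 := hm.energy_nonneg
    set A := energy (fun p => max (f p) (f q))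
    set B := energy (fun p => min (f p) (f q))
    have d : (f p - f z) ^ 2 ≤ (R + S) * (A + B) := by
      have hx : 0 ≤ f p - f q := sub_nonneg.2 h'
      have hy : 0 ≤ f q - f z := sub_nonneg.2 h
      have hRB := mul_nonneg h1.1 e2
      have hSA := mul_nonneg h2.1 e1
      have hxy : ((f p - f q) * (f q - f z)) ^ 2 ≤ (R * B) * (S * A) := by
        calc ((f p - f q) * (f q - f z)) ^ 2 = (f p - f q) ^ 2 * (f q - f z) ^ 2 := by ring
          _ ≤ (R * A) * (S * B) := mul_le_mul c1 c2 (sq_nonneg _) (mul_nonneg h1.1 e1)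
          _ = _ := by ring
      have h2xy : 2 * ((f p - f q) * (f q - f z)) ≤ R * B + S * A := by
        apply le_of_sq_le_sq _ (add_nonneg hRB hSA)
        nlinarith [sq_nonneg (R * B - S * A)]
      nlinarith
    exact d.trans (mul_le_mul_of_nonneg_left hs (add_nonneg h1.1 h2.1))
  intro f hf
  rcases le_total (f z) (f p) with h | h
  · exact main h1 h2 f hf h
  · have := main h2.symm h1.symm f hf h
    linarith [this, (by ring : (f p - f z) ^ 2 = (f z - f p) ^ 2), add_comm R S]

theorem ResistanceBound.cellMap {b : ℕ} [NeZero b] {p q : Vert b} {R : ℝ}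
    (h : ResistanceBound p q R) (i : Cell b) :
    ResistanceBound (cellMap i p) (cellMap i q) (ren b * R) := by
  refine ⟨mul_nonneg (ren_pos b).le h.1, fun f hf => ?_⟩
  obtain ⟨h1, h2⟩ := hf.comp_cellMap i
  calc _ ≤ R * energy (f ∘ BubbleDiamond.cellMap i) := h.2 _ h1
    _ ≤ R * (ren b * energy f) := mul_le_mul_of_nonneg_left h2 h.1
    _ = _ := by ring

theorem resistanceBound_bdry (b : ℕ) :
    ResistanceBound (Vert.bdry 0 : Vert b) (Vert.bdry 1) 1 :=
  ⟨zero_le_one, fun f hf => by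
    rw [one_mul, ← graphEnergy_zero]; exact hf.graphEnergy_le 0⟩

theorem resistanceBound_self {b : ℕ} (p : Vert b) : ResistanceBound p p 0 :=
  ⟨le_rfl, fun f _ => by simp⟩

theorem exists_resistanceBound_root {b : ℕ} [NeZero b] (p : Vert b) :
    ∃ R, ResistanceBound (Vert.bdry 0) p R := by
  have h00 := resistanceBound_bdry b
  have hL : ResistanceBound (Vert.bdry 0 : Vert b) (Vert.inner [] 0) (ren b * 1) := by
    simpa [cellMap] using h00.cellMap (Sum.inr 0)
  have hM : ResistanceBound (Vert.inner [] 0 : Vert b) (Vert.inner [] 1) (ren b * 1) := by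
    simpa [cellMap] using h00.cellMap (Sum.inl ⟨0, Nat.pos_of_ne_zero (NeZero.ne b)⟩)
  have hi : ∀ k, ∃ R, ResistanceBound (Vert.bdry 0 : Vert b) (Vert.inner [] k) R := by
    intro k; fin_cases k
    exacts [⟨_, hL⟩, ⟨_, hL.trans hM⟩]
  have hroot : ∀ i : Cell b, ∃ R, ResistanceBound (Vert.bdry 0 : Vert b)
      (cellMap i (Vert.bdry 0)) R := by
    rintro (i | k)
    · exact hi 0
    · fin_cases k
      · exact ⟨0, resistanceBound_self _⟩
      · exact hi 1
  cases p with
  | bdry k => fin_cases k; exacts [⟨0, resistanceBound_self _⟩, ⟨1, h00⟩]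
  | inner w k =>
    induction w with
    | nil => exact hi k
    | cons i w ih =>
      obtain ⟨R, hR⟩ := ih
      obtain ⟨S, hS⟩ := hroot i
      have := hS.trans (hR.cellMap i)
      exact ⟨_, by cases i <;> exact this⟩

theorem exists_resistanceBound {b : ℕ} [NeZero b] (p q : Vert b) : ∃ R, ResistanceBound p q R := by
  obtain ⟨R, hR⟩ := exists_resistanceBound_root p
  obtain ⟨S, hS⟩ := exists_resistanceBound_root q
  exact ⟨_, hR.symm.trans hS⟩

theorem ResistanceBound.resistance_le {b : ℕ} {p q : Vert b} {R : ℝ} (h : ResistanceBound p q R) :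
    resistance p q ≤ R := csInf_le ⟨0, fun _ hx => hx.1⟩ h

theorem resistanceBound_resistance {b : ℕ} [NeZero b] (p q : Vert b) :
    ResistanceBound p q (resistance p q) := by
  obtain ⟨R, hR⟩ := exists_resistanceBound p q
  refine ⟨Real.sInf_nonneg fun _ hx => hx.1, fun f hf => ?_⟩
  rcases hf.energy_nonneg.eq_or_lt with h | h
  · have := hR.2 f hf
    rw [← h] at this ⊢; simpa using this
  · rw [← div_le_iff₀ h]
    exact le_csInf ⟨R, hR⟩ fun S hS => (div_le_iff₀ h).2 (hS.2 f hf)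

/-- The vertices with the resistance metric. -/
noncomputable instance (b : ℕ) [NeZero b] : PseudoMetricSpace (Vert b) where
  dist := resistance
  dist_self p := le_antisymm (resistanceBound_self p).resistance_le (resistanceBound_resistance p p).1
  dist_comm p q := le_antisymm (resistanceBound_resistance q p).symm.resistance_le
    (resistanceBound_resistance p q).symm.resistance_le
  dist_triangle p q z :=
    ((resistanceBound_resistance p q).trans (resistanceBound_resistance q z)).resistance_le

theorem dist_cellMap_le {b : ℕ} [NeZero b] (i : Cell b) (p q : Vert b) :
    dist (cellMap i p) (cellMap i q) ≤ ren b * dist p q :=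
  ((resistanceBound_resistance p q).cellMap i).resistance_le


/-- The bubble-diamond fractal `K_b`: the completion of the vertices in the resistance metric. -/
abbrev Fractal (b : ℕ) [NeZero b] : Type := UniformSpace.Completion (Vert b)

noncomputable instance (b : ℕ) [NeZero b] : MeasurableSpace (Fractal b) := borel _

instance (b : ℕ) [NeZero b] : BorelSpace (Fractal b) := ⟨rfl⟩

/-- The continuous extension of `F_i` to `K_b`. -/
noncomputable def cellMapK {b : ℕ} [NeZero b] (i : Cell b) : Fractal b → Fractal b :=
  UniformSpace.Completion.map (cellMap i)

theorem uniformContinuous_cellMap {b : ℕ} [NeZero b] (i : Cell b) :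
    UniformContinuous (cellMap i : Vert b → Vert b) :=
  (LipschitzWith.of_dist_le_mul (K := ⟨ren b, (ren_pos b).le⟩)
    (dist_cellMap_le i)).uniformContinuous

theorem cellMapK_coe {b : ℕ} [NeZero b] (i : Cell b) (p : Vert b) :
    cellMapK i (p : Fractal b) = (cellMap i p : Vert b) :=
  UniformSpace.Completion.map_coe (uniformContinuous_cellMap i) p

theorem continuous_cellMapK {b : ℕ} [NeZero b] (i : Cell b) :
    Continuous (cellMapK i : Fractal b → Fractal b) := UniformSpace.Completion.continuous_map

instance (b : ℕ) [NeZero b] : Nonempty (Fractal b) := ⟨((Vert.bdry 0 : Vert b) : Fractal b)⟩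

instance (b : ℕ) : MeasurableSingletonClass (Cell b) :=
  ⟨by
    rintro (i | i)
    · rw [← Set.image_singleton]; exact measurableSet_inl_image.2 (MeasurableSet.singleton i)
    · rw [← Set.image_singleton]; exact measurableSet_inr_image.2 (MeasurableSet.singleton i)⟩

/-- The uniform probability on the `b + 2` cells. -/
noncomputable def cellProb (b : ℕ) : Measure (Cell b) := (PMF.uniformOfFintype (Cell b)).toMeasure

instance (b : ℕ) : IsProbabilityMeasure (cellProb b) := by unfold cellProb; infer_instance

/-- The point `F_{x₀} ∘ ⋯ ∘ F_{x_{n-1}} (q₁)` of `K_b`. -/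
noncomputable def approx {b : ℕ} [NeZero b] (n : ℕ) (x : ℕ → Cell b) : Fractal b :=
  (wordMap (List.ofFn fun i : Fin n => x i) (Vert.bdry 0) : Vert b)

/-- The point of `K_b` with address `x`. -/
noncomputable def codeMap {b : ℕ} [NeZero b] (x : ℕ → Cell b) : Fractal b :=
  limUnder atTop fun n : ℕ => approx n x

/-- The self-similar probability measure `μ` on `K_b`: the law of the point with uniformly random
address. `isProbabilityMeasure_selfSimilarMeasure` and `selfSimilarMeasure_apply` show
`μ(K_b) = 1` and `μ(A) = (b + 2)⁻¹ ∑ μ(F_i⁻¹ A)`. -/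
noncomputable def selfSimilarMeasure (b : ℕ) [NeZero b] : Measure (Fractal b) :=
  (Measure.infinitePi fun _ : ℕ => cellProb b).map codeMap

theorem dist_wordMap_le {b : ℕ} [NeZero b] (w : List (Cell b)) (p q : Vert b) :
    dist (wordMap w p) (wordMap w q) ≤ ren b ^ w.length * dist p q := by
  induction w with
  | nil => simp [wordMap]
  | cons i w ih =>
    calc _ ≤ ren b * dist (wordMap w p) (wordMap w q) := dist_cellMap_le i _ _
      _ ≤ ren b * (ren b ^ w.length * dist p q) := mul_le_mul_of_nonneg_left ih (ren_pos b).le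
      _ = _ := by rw [List.length_cons, pow_succ]; ring

theorem ren_lt_one (b : ℕ) : ren b < 1 := by
  rw [ren, div_lt_one (by positivity)]
  linarith [(Nat.cast_nonneg b : (0 : ℝ) ≤ b)]

theorem tendsto_approx {b : ℕ} [NeZero b] (x : ℕ → Cell b) :
    Tendsto (fun n : ℕ => approx n x) atTop (𝓝 (codeMap x)) := by
  set C : ℝ := ∑ i : Cell b, dist (Vert.bdry 0) (cellMap i (Vert.bdry 0)) with hC
  have hcs : CauchySeq fun n : ℕ => approx n x := by
    refine cauchySeq_of_le_geometric (ren b) C (ren_lt_one b) fun n => ?_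
    have h1 : wordMap (List.ofFn fun i : Fin (n + 1) => x i) (Vert.bdry 0) =
        wordMap (List.ofFn fun i : Fin n => x i) (cellMap (x n) (Vert.bdry 0)) := by
      rw [List.ofFn_succ', List.concat_eq_append, wordMap_append]
      simp [wordMap]
    rw [approx, approx, h1, UniformSpace.Completion.dist_eq]
    refine (dist_wordMap_le _ _ _).trans ?_
    rw [List.length_ofFn, mul_comm]
    exact mul_le_mul_of_nonneg_right (Finset.single_le_sum
      (f := fun i : Cell b => dist (Vert.bdry 0) (cellMap i (Vert.bdry 0)))
      (fun _ _ => dist_nonneg) (Finset.mem_univ (x n))) (pow_nonneg (ren_pos b).le _)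
  exact tendsto_nhds_limUnder (cauchySeq_tendsto_of_complete hcs)

theorem measurable_codeMap {b : ℕ} [NeZero b] : Measurable (codeMap : (ℕ → Cell b) → Fractal b) := by
  refine measurable_of_tendsto_metrizable (f := fun n x => approx n x) (fun n => ?_)
    (tendsto_pi_nhds.2 fun x => tendsto_approx x)
  have : Measurable fun y : Fin n → Cell b =>
      ((wordMap (List.ofFn y) (Vert.bdry 0) : Vert b) : Fractal b) := measurable_of_finite _
  exact this.comp (measurable_pi_lambda _ fun i => measurable_pi_apply (i : ℕ))

/-- The sequence `i, x₀, x₁, …`. -/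
def consSeq {b : ℕ} (i : Cell b) (x : ℕ → Cell b) : ℕ → Cell b
  | 0 => i
  | n + 1 => x n

theorem codeMap_consSeq {b : ℕ} [NeZero b] (i : Cell b) (x : ℕ → Cell b) :
    codeMap (consSeq i x) = cellMapK i (codeMap x) := by
  refine tendsto_nhds_unique ((tendsto_approx (consSeq i x)).comp (tendsto_add_atTop_nat 1)) ?_
  convert ((continuous_cellMapK i).tendsto _).comp (tendsto_approx x) using 1
  funext n
  simp [approx, cellMapK_coe, List.ofFn_succ, wordMap, consSeq]

theorem measurable_consSeq {b : ℕ} :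
    Measurable fun z : Cell b × (ℕ → Cell b) => consSeq z.1 z.2 := by
  refine measurable_pi_lambda _ fun n => ?_
  cases n with
  | zero => exact measurable_fst
  | succ n => exact (measurable_pi_apply n).comp measurable_snd

theorem map_consSeq (b : ℕ) :
    ((cellProb b).prod (Measure.infinitePi fun _ : ℕ => cellProb b)).map
      (fun z => consSeq z.1 z.2) = Measure.infinitePi fun _ : ℕ => cellProb b := by
  refine Measure.eq_infinitePi _ fun s t ht => ?_
  rw [Measure.map_apply measurable_consSeq (.pi s.countable_toSet fun i _ => ht i)]
  have hinj : Set.InjOn Nat.succ (Nat.succ ⁻¹' (s : Set ℕ)) := Nat.succ_injective.injOn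
  have : (fun z : Cell b × (ℕ → Cell b) => consSeq z.1 z.2) ⁻¹' (Set.pi s t) =
      (if 0 ∈ s then t 0 else Set.univ) ×ˢ
        Set.pi (s.preimage Nat.succ hinj : Finset ℕ) (fun n => t (n + 1)) := by
    ext ⟨i, x⟩
    simp only [Set.mem_preimage, Set.mem_pi, Set.mem_prod, Finset.mem_coe, Finset.mem_preimage]
    constructor
    · intro h
      refine ⟨?_, fun n hn => h _ hn⟩
      split_ifs with h0
      · exact h 0 h0
      · trivial
    · rintro ⟨h0, h1⟩ (_ | n) hn
      · rw [if_pos hn] at h0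
        exact h0
      · exact h1 n hn
  classical
  rw [this, Measure.prod_prod, Measure.infinitePi_pi _ (fun i _ => ht _),
    Finset.prod_preimage' Nat.succ s hinj fun n => cellProb b (t n),
    ← Finset.prod_filter_mul_prod_filter_not s (· ∈ Set.range Nat.succ), mul_comm]
  congr 1
  have : s.filter (fun n => n ∉ Set.range Nat.succ) = if 0 ∈ s then {0} else ∅ := by
    ext n
    cases n <;> split_ifs <;> simp_all
  rw [this]
  split_ifs <;> simp

theorem isProbabilityMeasure_selfSimilarMeasure (b : ℕ) [NeZero b] :
    IsProbabilityMeasure (selfSimilarMeasure b) :=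
  Measure.isProbabilityMeasure_map measurable_codeMap.aemeasurable

theorem selfSimilarMeasure_apply {b : ℕ} [NeZero b] {A : Set (Fractal b)} (hA : MeasurableSet A) :
    selfSimilarMeasure b A =
      (1 / (b + 2 : ENNReal)) * ∑ i : Cell b, selfSimilarMeasure b (cellMapK i ⁻¹' A) := by
  have hm : Measurable fun z : Cell b × (ℕ → Cell b) => codeMap (consSeq z.1 z.2) :=
    measurable_codeMap.comp measurable_consSeq
  rw [selfSimilarMeasure, Measure.map_apply measurable_codeMap hA]
  conv_lhs => rw [← map_consSeq]
  rw [Measure.map_apply measurable_consSeq (measurable_codeMap hA), ← Set.preimage_comp]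
  change ((cellProb b).prod _) ((fun z : Cell b × (ℕ → Cell b) => codeMap (consSeq z.1 z.2)) ⁻¹' A) = _
  rw [Measure.prod_apply (hm hA), lintegral_fintype, Finset.mul_sum]
  refine Finset.sum_congr rfl fun i _ => ?_
  rw [Measure.map_apply measurable_codeMap ((continuous_cellMapK i).measurable hA), mul_comm]
  congr 1
  · rw [cellProb, PMF.toMeasure_apply_singleton _ _ (MeasurableSet.singleton i)]
    simp
  · congr 1
    ext x
    simp [codeMap_consSeq]

/-- The boundary points of `K_b`: `q b 0` is `q₁` and `q b 1` is `q₂`. -/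
noncomputable def q (b : ℕ) [NeZero b] (k : Fin 2) : Fractal b := (Vert.bdry k : Vert b)

/-- The restriction of a function on `K_b` to the vertices. -/
noncomputable def restrict {b : ℕ} [NeZero b] (u : Fractal b → ℝ) : Vert b → ℝ := fun p => u p

/-- The bilinear form `𝓔(f, g)`, by polarization. -/
noncomputable def energyForm {b : ℕ} (f g : Vert b → ℝ) : ℝ :=
  (1 / 4) * (energy (f + g) - energy (f - g))

/-- `u ∈ dom 𝓔`, for `u` on `K_b`. Every function of finite energy on the vertices is uniformly
continuous, and is identified with its continuous extension. -/
def InDomEnergy {b : ℕ} [NeZero b] (u : Fractal b → ℝ) : Prop :=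
  Continuous u ∧ FiniteEnergy (restrict u)

/-- `u ∈ dom Δ` and `Δ u = f`. -/
def HasLaplacian {b : ℕ} [NeZero b] (u f : Fractal b → ℝ) : Prop :=
  InDomEnergy u ∧ Continuous f ∧ ∀ g : Fractal b → ℝ, InDomEnergy g → g (q b 0) = 0 →
    g (q b 1) = 0 →
      energyForm (restrict u) (restrict g) = - ∫ x, f x * g x ∂(selfSimilarMeasure b)

/-- `Δ^m u` is defined and equal to `v`. -/
def HasIterLaplacian {b : ℕ} [NeZero b] : ℕ → (Fractal b → ℝ) → (Fractal b → ℝ) → Prop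
  | 0, u, v => u = v
  | m + 1, u, v => ∃ w, HasLaplacian u w ∧ HasIterLaplacian m w v

/-- The neighbour of the boundary point with index `k` in the `m`-th graph: `F^m` applied to the
other boundary point, where `F` is the map of the end cell at that boundary point. -/
noncomputable def neighbour (b : ℕ) [NeZero b] (k : Fin 2) (m : ℕ) : Fractal b :=
  (wordMap (List.replicate m (Sum.inr k)) (Vert.bdry k.rev) : Vert b)

/-- The normal derivative of `u` at the boundary point with index `k` exists and equals `d`. -/
def HasNormalDeriv {b : ℕ} [NeZero b] (u : Fractal b → ℝ) (k : Fin 2) (d : ℝ) : Prop :=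
  Tendsto (fun m : ℕ => ((ren b) ^ m)⁻¹ * (u (q b k) - u (neighbour b k m))) atTop (𝓝 d)

/-- The normal derivative of `u` at the boundary point with index `k`. -/
noncomputable def normalDeriv {b : ℕ} [NeZero b] (u : Fractal b → ℝ) (k : Fin 2) : ℝ :=
  limUnder atTop fun m : ℕ => ((ren b) ^ m)⁻¹ * (u (q b k) - u (neighbour b k m))

/-- `f ∈ 𝓗_j`: polynomials of degree at most `j`, that is, `Δ^{j+1} f = 0`. -/
def IsPolynomial {b : ℕ} [NeZero b] (j : ℕ) (f : Fractal b → ℝ) : Prop :=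
  HasIterLaplacian (j + 1) f 0

/-- `f = f_{jk}`: `f ∈ 𝓗_j` and `Δ^m f (q_n) = δ_{jm} δ_{kn}`. The indices `k`, `n` are `0`, `1`
for the usual `1`, `2`. -/
def IsMultiharmonic (b : ℕ) [NeZero b] (j : ℕ) (k : Fin 2) (f : Fractal b → ℝ) : Prop :=
  IsPolynomial j f ∧ ∀ m ≤ j, ∃ v, HasIterLaplacian m f v ∧
    ∀ n : Fin 2, v (q b n) = if m = j ∧ n = k then 1 else 0

/-- `P = P_{jk}`: `P ∈ 𝓗_j`, `Δ^m P (q₁) = δ_{mj} δ_{k1}` and `∂ₙ Δ^m P (q₁) = δ_{mj} δ_{k2}` for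
`m ≤ j`. The index `k` is `0`, `1` for the usual `1`, `2`. -/
def IsMonomial (b : ℕ) [NeZero b] (j : ℕ) (k : Fin 2) (P : Fractal b → ℝ) : Prop :=
  IsPolynomial j P ∧ ∀ m ≤ j, ∃ v, HasIterLaplacian m P v ∧
    v (q b 0) = (if m = j ∧ k = 0 then 1 else 0) ∧
    HasNormalDeriv v 0 (if m = j ∧ k = 1 then 1 else 0)

/-- The multiharmonic function `f_{jk}`. -/
noncomputable def multiharmonic (b : ℕ) [NeZero b] (j : ℕ) (k : Fin 2) : Fractal b → ℝ :=
  Classical.epsilon (IsMultiharmonic b j k)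

/-- The monomial `P_{jk}`. -/
noncomputable def monomial (b : ℕ) [NeZero b] (j : ℕ) (k : Fin 2) : Fractal b → ℝ :=
  Classical.epsilon (IsMonomial b j k)

/-- The inner product `I(jk, j'k') = ∫ f_{jk} f_{j'k'} dμ`. -/
noncomputable def innerI (b : ℕ) [NeZero b] (j : ℕ) (k : Fin 2) (i : ℕ) (n : Fin 2) : ℝ :=
  ∫ x, multiharmonic b j k x * multiharmonic b i n x ∂(selfSimilarMeasure b)

/-- `α_j = P_{j1}(q₂)`. -/
noncomputable def alpha (b : ℕ) [NeZero b] (j : ℕ) : ℝ := monomial b j 0 (q b 1)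

/-- `β_j = P_{j2}(q₂)`. -/
noncomputable def beta (b : ℕ) [NeZero b] (j : ℕ) : ℝ := monomial b j 1 (q b 1)

/-- `η_j = ∂ₙ P_{j1}(q₂)`. -/
noncomputable def eta (b : ℕ) [NeZero b] (j : ℕ) : ℝ := normalDeriv (monomial b j 0) 1

/-- `γ_j = ∂ₙ P_{j2}(q₂)`. -/
noncomputable def gamma (b : ℕ) [NeZero b] (j : ℕ) : ℝ := normalDeriv (monomial b j 1) 1

/-- The constant `ζ_j`, for `j ≥ 2`. -/
noncomputable def zeta (b j : ℕ) : ℝ :=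
  ((b : ℝ) + 1) ^ 2 / (((b : ℝ) + 2) * (2 * b + 1) *
    (((b : ℝ) + 2) ^ (j - 1) * (2 * (b : ℝ) + 1) ^ (j - 1) / (b : ℝ) ^ (j - 1) - 1))

/-- The constant `ι_j`, for `j ≥ 1`. -/
noncomputable def iota (b j : ℕ) : ℝ :=
  ((b : ℝ) + 1) ^ 2 / ((2 * (b : ℝ) + 1) *
    (((b : ℝ) + 2) ^ j * (2 * (b : ℝ) + 1) ^ j / (b : ℝ) ^ j - 1))

end BubbleDiamond

namespace BubbleDiamond

open Filter Topology MeasureTheory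

section

variable {b : ℕ}

/-! ### Cells and compactness -/

/-! The weak equation `Δ u = f` is first replaced by a hierarchy of finite linear systems. When an
edge is refined, the values of `u` at its two new vertices are determined by the values at its ends
and by two integrals of `f` against piecewise harmonic functions (`IsSol` with source `src f`).
Solving downwards through the levels gives existence for any boundary values. A Green formula that
is exact on every level (`IsSol.graphForm_eq`) shows that the solution has finite energy and solves
the weak equation. Uniqueness of the Dirichlet problem gives the converse (`HasLaplacian.isSol`), so
the Laplacian and the vertex equations are equivalent. The normal derivative becomes the closed
expression `flux`.

The polynomials are then organised as towers `v` with `Δ v₀ = 0` and `Δ v_{m+1} = v_m`. Convolution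
makes towers a module over real power series, and a tower is determined by the generating functions
of its values and normal derivatives at `q₁`. The monomials realise the data `(1, 0)` and `(0, 1)`.
Hence the generating functions α, β, η, γ of the four sequences form a 2×2 transfer matrix, which
carries the Cauchy data at `q₁` to the value and outward flux at `q₂`.

Two symmetries determine this matrix up to a few initial values. Reflection gives `βη = 1 - α²` and
`γ = -α`. Self-similarity: on a cell a tower is again a tower after rescaling the variable by `s⁻¹`,
with `s = r / (b + 2)`, and the fluxes at each new vertex add up to zero. Transfer through an end
cell, the `b` middle cells and the other end cell gives `b α(z/s) = α ((b+1)² α² - (b²+b+1))` and `b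
β(z/s) = r β ((b+1)² α² - b²)`. Comparing coefficients gives the recursions for α and β. Those for η
and γ come from the basis of Dirichlet towers, whose normal derivatives are the inner products `a_l`
and `b_l` (`Tower.fluxSeries_eq`). -/

theorem exists_cellMap_eq (p : Vert b) : ∃ i p', cellMap i p' = p := by
  rcases p with k | ⟨_ | ⟨i, w⟩, k⟩
  · exact ⟨Sum.inr k, Vert.bdry k, by simp [cellMap]⟩
  · refine ⟨Sum.inr k, Vert.bdry k.rev, ?_⟩
    fin_cases k <;> simp [cellMap]
  · exact ⟨i, Vert.inner w k, by cases i <;> rfl⟩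

theorem cellMap_inner (i : Cell b) (w : List (Cell b)) (k : Fin 2) :
    cellMap i (Vert.inner w k) = Vert.inner (i :: w) k := by cases i <;> rfl

theorem exists_wordMap_eq (n : ℕ) (p : Vert b) :
    ∃ (w : Fin n → Cell b) (p' : Vert b), wordMap (List.ofFn w) p' = p := by
  induction n generalizing p with
  | zero => exact ⟨Fin.elim0, p, rfl⟩
  | succ n ih =>
    obtain ⟨i, p₁, rfl⟩ := exists_cellMap_eq p
    obtain ⟨w, p', rfl⟩ := ih p₁
    exact ⟨Fin.cons i w, p', by simp [List.ofFn_succ, wordMap]⟩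

variable [NeZero b]

theorem exists_dist_le (b : ℕ) [NeZero b] : ∃ C : ℝ, 0 ≤ C ∧ ∀ p q : Vert b, dist p q ≤ C := by
  set c : ℝ := ∑ i : Cell b, dist (Vert.bdry 0) (cellMap i (Vert.bdry 0)) with hc
  have hc0 : 0 ≤ c := Finset.sum_nonneg fun _ _ => dist_nonneg
  have hr := ren_pos b
  have hr1 : 0 < 1 - ren b := sub_pos.2 (ren_lt_one b)
  -- The bound must be stable under `C₀ ↦ c + r C₀`, which is how the distance from `q₁` grows on
  -- passing to a cell. The extra `1` makes `C₀ ≥ 1`, so that it also covers the distance from `q₁`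
  -- to `q₂`.
  set C₀ : ℝ := (c + 1) / (1 - ren b) with hC₀
  have hC : (1 - ren b) * C₀ = c + 1 := mul_div_cancel₀ _ hr1.ne'
  have h1 : 1 ≤ C₀ := by rw [hC₀, le_div_iff₀ hr1]; linarith
  have hb (k : Fin 2) : dist (Vert.bdry 0 : Vert b) (Vert.bdry k) ≤ C₀ := by
    fin_cases k
    · simpa using zero_le_one.trans h1
    · exact (resistanceBound_bdry b).resistance_le.trans h1
  have hstep (i : Cell b) (p : Vert b) (hp : dist (Vert.bdry 0) p ≤ C₀) :
      dist (Vert.bdry 0) (cellMap i p) ≤ C₀ := by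
    have h2 : dist (Vert.bdry 0) (cellMap i (Vert.bdry 0)) ≤ c :=
      Finset.single_le_sum (f := fun i : Cell b => dist (Vert.bdry 0) (cellMap i (Vert.bdry 0)))
        (fun _ _ => dist_nonneg) (Finset.mem_univ i)
    have h3 := dist_triangle (Vert.bdry 0) (cellMap i (Vert.bdry 0)) (cellMap i p)
    have h4 := dist_cellMap_le i (Vert.bdry 0) p
    nlinarith
  have hroot (p : Vert b) : dist (Vert.bdry 0) p ≤ C₀ := by
    rcases p with k | ⟨w, k⟩
    · exact hb k
    · induction w with
      | nil =>
        have := hstep (Sum.inr k) (Vert.bdry k.rev) (hb _)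
        fin_cases k <;> simpa [cellMap] using this
      | cons i w ih => exact cellMap_inner i w k ▸ hstep i _ ih
  refine ⟨C₀ + C₀, by linarith, fun p q => ?_⟩
  exact (dist_triangle_left p q (Vert.bdry 0)).trans (add_le_add (hroot p) (hroot q))

theorem exists_pow_ren_mul_lt (b : ℕ) (C : ℝ) {ε : ℝ} (hε : 0 < ε) (hC : 0 ≤ C) [NeZero b] :
    ∃ n : ℕ, ren b ^ n * C < ε := by
  obtain ⟨n, hn⟩ := exists_pow_lt_of_lt_one (div_pos hε (by linarith : 0 < C + 1)) (ren_lt_one b)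
  refine ⟨n, ?_⟩
  rw [lt_div_iff₀ (by linarith)] at hn
  nlinarith [pow_nonneg (ren_pos b).le n]

/-- The finitely many cells of level `n` cover all vertices, and their diameters are at most `r^n`
times the total diameter. -/
theorem totallyBounded_univ_vert : TotallyBounded (Set.univ : Set (Vert b)) := by
  obtain ⟨C, hC0, hC⟩ := exists_dist_le b
  refine Metric.totallyBounded_iff.2 fun ε hε => ?_
  obtain ⟨n, hn⟩ := exists_pow_ren_mul_lt b C hε hC0
  refine ⟨Set.range fun w : Fin n → Cell b => wordMap (List.ofFn w) (Vert.bdry 0),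
    Set.finite_range _, fun p _ => ?_⟩
  obtain ⟨w, p', rfl⟩ := exists_wordMap_eq n p
  refine Set.mem_iUnion₂.2 ⟨_, ⟨w, rfl⟩, ?_⟩
  refine (dist_wordMap_le _ _ _).trans_lt ?_
  rw [List.length_ofFn]
  exact (mul_le_mul_of_nonneg_left (hC _ _) (pow_nonneg (ren_pos b).le _)).trans_lt hn

instance : CompactSpace (Fractal b) := by
  have h := (totallyBounded_univ_vert (b := b)).image
    (UniformSpace.Completion.uniformContinuous_coe (Vert b))
  rw [Set.image_univ] at h
  have h2 := h.closure
  rw [(UniformSpace.Completion.denseRange_coe (α := Vert b)).closure_range] at h2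
  exact ⟨isCompact_iff_totallyBounded_isComplete.2 ⟨h2, isClosed_univ.isComplete⟩⟩

theorem exists_dist_le_fractal (b : ℕ) [NeZero b] :
    ∃ C : ℝ, 0 ≤ C ∧ ∀ x y : Fractal b, dist x y ≤ C := by
  obtain ⟨C, hC0, hC⟩ := exists_dist_le b
  refine ⟨C, hC0, fun x y => ?_⟩
  induction x, y using UniformSpace.Completion.induction_on₂ with
  | hp => exact isClosed_le (by fun_prop) (by fun_prop)
  | ih p q => rw [UniformSpace.Completion.dist_eq]; exact hC p q

theorem dist_cellMapK_le (i : Cell b) (x y : Fractal b) :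
    dist (cellMapK i x) (cellMapK i y) ≤ ren b * dist x y := by
  have := continuous_cellMapK i
  induction x, y using UniformSpace.Completion.induction_on₂ with
  | hp => exact isClosed_le (by fun_prop) (by fun_prop)
  | ih p q =>
    rw [cellMapK_coe, cellMapK_coe, UniformSpace.Completion.dist_eq,
      UniformSpace.Completion.dist_eq]
    exact dist_cellMap_le i p q

/-- The continuous extension of `F_w` to `K_b`. -/
noncomputable def wordMapK : List (Cell b) → Fractal b → Fractal b
  | [], x => x
  | i :: w, x => cellMapK i (wordMapK w x)

theorem continuous_wordMapK (w : List (Cell b)) : Continuous (wordMapK w) := by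
  induction w with
  | nil => exact continuous_id
  | cons i w ih => exact (continuous_cellMapK i).comp ih

theorem wordMapK_coe (w : List (Cell b)) (p : Vert b) :
    wordMapK w (p : Fractal b) = (wordMap w p : Vert b) := by
  induction w with
  | nil => rfl
  | cons i w ih => rw [wordMapK, ih, cellMapK_coe]; rfl

theorem wordMapK_append (v w : List (Cell b)) (x : Fractal b) :
    wordMapK (v ++ w) x = wordMapK v (wordMapK w x) := by
  induction v with
  | nil => rfl
  | cons i v ih => simp [wordMapK, ih]

theorem dist_wordMapK_le (w : List (Cell b)) (x y : Fractal b) :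
    dist (wordMapK w x) (wordMapK w y) ≤ ren b ^ w.length * dist x y := by
  induction w with
  | nil => simp [wordMapK]
  | cons i w ih =>
    calc _ ≤ ren b * dist (wordMapK w x) (wordMapK w y) := dist_cellMapK_le i _ _
      _ ≤ ren b * (ren b ^ w.length * dist x y) := mul_le_mul_of_nonneg_left ih (ren_pos b).le
      _ = _ := by rw [List.length_cons, pow_succ]; ring

/-- A continuous function oscillates little on all cells of a high enough level. -/
theorem exists_oscillation_le {f : Fractal b → ℝ} (hf : Continuous f) {ε : ℝ} (hε : 0 < ε) :
    ∃ n : ℕ, ∀ m, n ≤ m → ∀ w : List (Cell b), w.length = m → ∀ x y,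
      |f (wordMapK w x) - f (wordMapK w y)| ≤ ε := by
  obtain ⟨C, hC0, hC⟩ := exists_dist_le_fractal b
  obtain ⟨δ, hδ, h⟩ := Metric.uniformContinuous_iff.1
    (CompactSpace.uniformContinuous_of_continuous hf) ε hε
  obtain ⟨n, hn⟩ := exists_pow_ren_mul_lt b C hδ hC0
  refine ⟨n, fun m hm w hw x y => (h ?_).le⟩
  refine (dist_wordMapK_le w x y).trans_lt (lt_of_le_of_lt ?_ hn)
  rw [hw]
  exact mul_le_mul (pow_le_pow_of_le_one (ren_pos b).le (ren_lt_one b).le hm) (hC x y)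
    dist_nonneg (pow_nonneg (ren_pos b).le _)

theorem exists_forall_abs_le {f : Fractal b → ℝ} (hf : Continuous f) :
    ∃ N : ℝ, 0 ≤ N ∧ ∀ x, |f x| ≤ N := by
  obtain ⟨N, hN⟩ := isCompact_univ.exists_bound_of_continuousOn hf.continuousOn
  exact ⟨N, (norm_nonneg _).trans (hN (q b 0) trivial), fun x => hN x trivial⟩

theorem eq_of_forall_coe {f g : Fractal b → ℝ} (hf : Continuous f) (hg : Continuous g)
    (h : restrict f = restrict g) : f = g := by
  funext x
  induction x using UniformSpace.Completion.induction_on with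
  | hp => exact isClosed_eq hf hg
  | ih p => exact congrFun h p

/-! ### Integration -/

instance : IsProbabilityMeasure (selfSimilarMeasure b) := isProbabilityMeasure_selfSimilarMeasure b

theorem integrable_of_continuous {f : Fractal b → ℝ} (hf : Continuous f) :
    Integrable f (selfSimilarMeasure b) :=
  hf.integrable_of_hasCompactSupport (HasCompactSupport.of_compactSpace f)

theorem integral_selfSimilarMeasure {f : Fractal b → ℝ} (hf : Continuous f) :
    ∫ x, f x ∂selfSimilarMeasure b =
      ((b : ℝ) + 2)⁻¹ * ∑ i : Cell b, ∫ x, f (cellMapK i x) ∂selfSimilarMeasure b := by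
  have hm (i : Cell b) := (continuous_cellMapK i).measurable
  have h : selfSimilarMeasure b = (1 / (b + 2 : ENNReal)) •
      ∑ i : Cell b, (selfSimilarMeasure b).map (cellMapK i) := by
    ext A hA
    rw [selfSimilarMeasure_apply hA]
    simp [Measure.map_apply (hm _) hA, mul_add]
  have hi (i : Cell b) : Integrable f ((selfSimilarMeasure b).map (cellMapK i)) := by
    rw [integrable_map_measure hf.aestronglyMeasurable (hm i).aemeasurable]
    exact integrable_of_continuous (hf.comp (continuous_cellMapK i))
  conv_lhs => rw [h]
  rw [integral_smul_measure, integral_finsetSum_measure fun i _ => hi i]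
  congr 1
  · rw [one_div, ENNReal.toReal_inv, ENNReal.toReal_add (by simp) (by simp)]
    simp
  · exact Finset.sum_congr rfl fun i _ => integral_map (hm i).aemeasurable hf.aestronglyMeasurable

theorem abs_integral_le {f : Fractal b → ℝ} {C : ℝ} (h : ∀ x, |f x| ≤ C) :
    |∫ x, f x ∂selfSimilarMeasure b| ≤ C := by
  simpa using norm_integral_le_of_norm_le_const (μ := selfSimilarMeasure b) (f := f)
    (Filter.Eventually.of_forall h)

/-! ### Extension of functions of finite energy -/

/-- The resistance estimate `|f p - f q|² ≤ R(p,q) 𝓔(f)` makes `f` Hölder continuous of exponent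
1/2. -/
theorem FiniteEnergy.uniformContinuous {f : Vert b → ℝ} (hf : FiniteEnergy f) :
    UniformContinuous f := by
  refine Metric.uniformContinuous_iff.2 fun ε hε => ?_
  have hE := hf.energy_nonneg
  refine ⟨ε ^ 2 / (energy f + 1), by positivity, fun {p q} h => ?_⟩
  have h1 := (resistanceBound_resistance p q).2 f hf
  have h3 : 0 ≤ resistance p q := dist_nonneg (x := p)
  have h2 : resistance p q * (energy f + 1) < ε ^ 2 := (lt_div_iff₀ (by positivity)).1 h
  rw [Real.dist_eq]
  refine abs_lt_of_sq_lt_sq ?_ hε.le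
  nlinarith

/-- The continuous extension to `K_b` of a function on the vertices. -/
noncomputable def extendK (f : Vert b → ℝ) : Fractal b → ℝ := UniformSpace.Completion.extension f

theorem FiniteEnergy.continuous_extendK {f : Vert b → ℝ} (_hf : FiniteEnergy f) :
    Continuous (extendK f) := UniformSpace.Completion.continuous_extension

theorem FiniteEnergy.restrict_extendK {f : Vert b → ℝ} (hf : FiniteEnergy f) :
    restrict (extendK f) = f :=
  funext fun p => UniformSpace.Completion.extension_coe hf.uniformContinuous p

end

section

variable {b : ℕ}

/-! ### The vertex equations -/

/-- The equations that a function `g` with Laplacian satisfies at the two new vertices of each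
edge, with source terms `s`. -/
def IsSol (s : List (Cell b) → Fin 2 → ℝ) (g : Vert b → ℝ) : Prop :=
  ∀ w k, ((b : ℝ) + 1) * g (Vert.inner w k) - b * g (Vert.inner w k.rev) =
    g (wordMap w (Vert.bdry k)) - s w k

/-- The values at the first-level vertices, from the source terms and the boundary values. -/
noncomputable def innerVals (b : ℕ) (s x : Fin 2 → ℝ) (k : Fin 2) : ℝ :=
  (((b : ℝ) + 1) * (x k - s k) + b * (x k.rev - s k.rev)) / (2 * b + 1)

/-- The boundary values on a first-level cell, from the boundary values `x` and the values `y` at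
the first-level vertices. -/
def cellData (x y : Fin 2 → ℝ) : Cell b → Fin 2 → ℝ
  | Sum.inl _ => y
  | Sum.inr m => fun k => if k = m then x k else y m

/-- The values at the new vertices of the edge `w` of the solution with source terms `s` and boundary
values `x`. -/
noncomputable def solInner : List (Cell b) → (List (Cell b) → Fin 2 → ℝ) → (Fin 2 → ℝ) → Fin 2 → ℝ
  | [], s, x => innerVals b (s []) x
  | i :: w, s, x => solInner w (fun v => s (i :: v)) (cellData x (innerVals b (s []) x) i)

/-- The solution of the vertex equations with source terms `s` and boundary values `x`. -/
noncomputable def sol (s : List (Cell b) → Fin 2 → ℝ) (x : Fin 2 → ℝ) : Vert b → ℝ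
  | Vert.bdry k => x k
  | Vert.inner w k => solInner w s x k

theorem apply_cellMap_bdry (g : Vert b → ℝ) (i : Cell b) (k : Fin 2) :
    g (cellMap i (Vert.bdry k)) =
      cellData (fun k => g (Vert.bdry k)) (fun k => g (Vert.inner [] k)) i k := by
  rcases i with i | m
  · rfl
  · simp only [cellMap, cellData]
    split_ifs <;> rfl

theorem sol_comp_cellMap (s : List (Cell b) → Fin 2 → ℝ) (x : Fin 2 → ℝ) (i : Cell b) :
    sol s x ∘ cellMap i = sol (fun v => s (i :: v)) (cellData x (innerVals b (s []) x) i) := by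
  funext p
  rcases p with k | ⟨w, k⟩
  · exact apply_cellMap_bdry _ _ _
  · simp [cellMap_inner, sol, solInner]

/-- The equations for one edge involve only its ends and its two new vertices, so different cells
are coupled only through their boundary values. This is what lets every later induction pass to the
first-level cells. -/
theorem isSol_iff (s : List (Cell b) → Fin 2 → ℝ) (g : Vert b → ℝ) :
    IsSol s g ↔ (∀ k : Fin 2, ((b : ℝ) + 1) * g (Vert.inner [] k) - b * g (Vert.inner [] k.rev) =
      g (Vert.bdry k) - s [] k) ∧ ∀ i, IsSol (fun v => s (i :: v)) (g ∘ cellMap i) := by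
  constructor
  · intro h
    exact ⟨h [], fun i w k => by simpa [wordMap, cellMap_inner] using h (i :: w) k⟩
  · rintro ⟨h0, h1⟩ (_ | ⟨i, w⟩) k
    · exact h0 k
    · simpa [wordMap, cellMap_inner] using h1 i w k

/-- The 2×2 system has determinant `(b+1)² - b² = 2b + 1`. -/
theorem innerVals_eq (s x : Fin 2 → ℝ) (k : Fin 2) :
    ((b : ℝ) + 1) * innerVals b s x k - b * innerVals b s x k.rev = x k - s k := by
  have : (0 : ℝ) < 2 * b + 1 := by positivity
  simp only [innerVals, Fin.rev_rev]
  field_simp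
  ring

theorem isSol_sol (s : List (Cell b) → Fin 2 → ℝ) (x : Fin 2 → ℝ) : IsSol s (sol s x) := by
  intro w
  induction w generalizing s x with
  | nil => exact fun k => innerVals_eq _ x k
  | cons i w ih =>
    intro k
    have := ih (fun v => s (i :: v)) (cellData x (innerVals b (s []) x) i) k
    rw [← sol_comp_cellMap] at this
    simpa [wordMap, cellMap_inner] using this

theorem IsSol.inner_nil {s : List (Cell b) → Fin 2 → ℝ} {g : Vert b → ℝ} (h : IsSol s g)
    (k : Fin 2) : g (Vert.inner [] k) = innerVals b (s []) (fun k => g (Vert.bdry k)) k := by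
  have h1 := h [] k
  have h2 := h [] k.rev
  have : (0 : ℝ) < 2 * b + 1 := by positivity
  simp only [Fin.rev_rev, wordMap] at h1 h2
  rw [innerVals, eq_div_iff this.ne']
  linear_combination ((b : ℝ) + 1) * h1 + b * h2

theorem IsSol.eq_sol {s : List (Cell b) → Fin 2 → ℝ} {g : Vert b → ℝ} (h : IsSol s g) :
    g = sol s fun k => g (Vert.bdry k) := by
  funext p
  rcases p with k | ⟨w, k⟩
  · rfl
  · induction w generalizing s g with
    | nil => exact h.inner_nil k
    | cons i w ih =>
      have h1 := ih (((isSol_iff s g).1 h).2 i)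
      have h2 : (fun k => g (Vert.inner [] k)) = innerVals b (s []) fun k => g (Vert.bdry k) :=
        funext h.inner_nil
      simp only [Function.comp, cellMap_inner, apply_cellMap_bdry, h2] at h1
      exact h1

theorem IsSol.ext {s : List (Cell b) → Fin 2 → ℝ} {f g : Vert b → ℝ} (hf : IsSol s f)
    (hg : IsSol s g) (h : ∀ k, f (Vert.bdry k) = g (Vert.bdry k)) : f = g := by
  rw [hf.eq_sol, hg.eq_sol, funext h]

theorem IsSol.add {s t : List (Cell b) → Fin 2 → ℝ} {f g : Vert b → ℝ} (hf : IsSol s f)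
    (hg : IsSol t g) : IsSol (s + t) (f + g) := fun w k => by
  simp only [Pi.add_apply]
  linear_combination hf w k + hg w k

theorem IsSol.smul {s : List (Cell b) → Fin 2 → ℝ} {f : Vert b → ℝ} (hf : IsSol s f) (c : ℝ) :
    IsSol (c • s) (c • f) := fun w k => by
  simp only [Pi.smul_apply, smul_eq_mul]
  linear_combination c * hf w k

theorem abs_innerVals_le {s x : Fin 2 → ℝ} {M N : ℝ} (hx : ∀ k, |x k| ≤ M) (hs : ∀ k, |s k| ≤ N)
    (k : Fin 2) : |innerVals b s x k| ≤ M + N := by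
  have h1 (k : Fin 2) : |x k - s k| ≤ M + N := (abs_sub _ _).trans (add_le_add (hx k) (hs k))
  have h0 : (0 : ℝ) < 2 * b + 1 := by positivity
  have hb : (0 : ℝ) ≤ b := b.cast_nonneg
  rw [innerVals, abs_div, abs_of_pos h0, div_le_iff₀ h0]
  refine (abs_add_le _ _).trans ?_
  rw [abs_mul, abs_mul, abs_of_nonneg hb, abs_of_nonneg (by linarith : (0 : ℝ) ≤ b + 1)]
  nlinarith [h1 k, h1 k.rev]

/-- Bounds on the boundary and on the source terms bound a solution. -/
theorem IsSol.abs_le {s : List (Cell b) → Fin 2 → ℝ} {g : Vert b → ℝ} (h : IsSol s g) {M N : ℝ}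
    (hM : ∀ k, |g (Vert.bdry k)| ≤ M) (hN : ∀ w k, |s w k| ≤ (1 / 2) ^ w.length * N) (p : Vert b) :
    |g p| ≤ M + 2 * N := by
  have hN0 : 0 ≤ N := by simpa using (abs_nonneg _).trans (hN [] 0)
  rcases p with k | ⟨w, k⟩
  · linarith [hM k]
  · induction w generalizing s g M N with
    | nil =>
      rw [h.inner_nil]
      linarith [abs_innerVals_le hM (fun k => by simpa using hN [] k) k (b := b)]
    | cons i w ih =>
      have hy (k : Fin 2) : |g (Vert.inner [] k)| ≤ M + N := by
        rw [h.inner_nil]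
        exact abs_innerVals_le hM (fun k => by simpa using hN [] k) k
      -- On a cell the boundary bound grows to `M + N` while the source bound halves, and `(M + N) +
      -- 2 (N / 2) = M + 2 N` is unchanged.
      have := ih (((isSol_iff s g).1 h).2 i) (M := M + N) (N := N / 2) (fun k => ?_)
        (fun v k => ?_) (by linarith)
      · simp only [Function.comp, cellMap_inner] at this
        linarith
      · rw [Function.comp_apply, apply_cellMap_bdry g]
        rcases i with i | m
        · exact hy k
        · simp only [cellData]
          split_ifs
          · linarith [hM k]
          · exact hy m
      · have := hN (i :: v) k
        rw [List.length_cons, pow_succ] at this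
        linarith

/-! ### The bilinear graph energies -/

/-- The bilinear form of the graph energy. -/
noncomputable def graphForm (l : ℕ) (f g : Vert b → ℝ) : ℝ :=
  ((ren b) ^ l)⁻¹ * ∑ w : Fin l → Cell b,
    (f (wordMap (List.ofFn w) (Vert.bdry 0)) - f (wordMap (List.ofFn w) (Vert.bdry 1))) *
    (g (wordMap (List.ofFn w) (Vert.bdry 0)) - g (wordMap (List.ofFn w) (Vert.bdry 1)))

theorem graphForm_self (l : ℕ) (f : Vert b → ℝ) : graphForm l f f = graphEnergy l f := by
  simp [graphForm, graphEnergy, sq]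

theorem graphForm_zero (f g : Vert b → ℝ) : graphForm 0 f g =
    (f (Vert.bdry 0) - f (Vert.bdry 1)) * (g (Vert.bdry 0) - g (Vert.bdry 1)) := by
  simp [graphForm, wordMap]

theorem graphEnergy_add_eq (l : ℕ) (f g : Vert b → ℝ) : graphEnergy l (f + g) =
    graphEnergy l f + graphEnergy l g + 2 * graphForm l f g := by
  simp only [graphForm, graphEnergy, Finset.mul_sum, ← Finset.sum_add_distrib]
  refine Finset.sum_congr rfl fun w _ => ?_
  simp only [Pi.add_apply]
  ring

theorem graphEnergy_sub_eq (l : ℕ) (f g : Vert b → ℝ) : graphEnergy l (f - g) =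
    graphEnergy l f + graphEnergy l g - 2 * graphForm l f g := by
  simp only [graphForm, graphEnergy, Finset.mul_sum, ← Finset.sum_add_distrib,
    ← Finset.sum_sub_distrib]
  refine Finset.sum_congr rfl fun w _ => ?_
  simp only [Pi.sub_apply]
  ring

theorem graphForm_eq (l : ℕ) (f g : Vert b → ℝ) : graphForm l f g =
    (1 / 4) * (graphEnergy l (f + g) - graphEnergy l (f - g)) := by
  rw [graphEnergy_add_eq, graphEnergy_sub_eq]; ring

theorem graphForm_succ (l : ℕ) (f g : Vert b → ℝ) : graphForm (l + 1) f g =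
    (ren b)⁻¹ * ∑ i : Cell b, graphForm l (f ∘ cellMap i) (g ∘ cellMap i) := by
  simp only [graphForm_eq, graphEnergy_succ, ← Finset.mul_sum, Finset.sum_sub_distrib]
  have h1 (i : Cell b) : (f + g) ∘ cellMap i = f ∘ cellMap i + g ∘ cellMap i := rfl
  have h2 (i : Cell b) : (f - g) ∘ cellMap i = f ∘ cellMap i - g ∘ cellMap i := rfl
  simp only [h1, h2]
  ring

theorem FiniteEnergy.add_sub {f g : Vert b → ℝ} (hf : FiniteEnergy f) (hg : FiniteEnergy g) :
    FiniteEnergy (f + g) ∧ FiniteEnergy (f - g) := by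
  have h (l : ℕ) : graphEnergy l (f + g) + graphEnergy l (f - g) ≤ 2 * energy f + 2 * energy g := by
    rw [graphEnergy_add_eq, graphEnergy_sub_eq]
    linarith [hf.graphEnergy_le l, hg.graphEnergy_le l]
  exact ⟨(FiniteEnergy.of_le (C := 2 * energy f + 2 * energy g) fun l => by
      linarith [h l, graphEnergy_nonneg l (f - g)]).1,
    (FiniteEnergy.of_le (C := 2 * energy f + 2 * energy g) fun l => by
      linarith [h l, graphEnergy_nonneg l (f + g)]).1⟩

theorem FiniteEnergy.of_graphForm {f : Vert b → ℝ} {A : ℝ}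
    (h : ∀ l, graphForm l f f ≤ A) : FiniteEnergy f :=
  (FiniteEnergy.of_le fun l => (graphForm_self l f).symm.trans_le (h l)).1

theorem IsSol.nonneg {h : Vert b → ℝ} (hh : IsSol 0 h) (h0 : ∀ k, 0 ≤ h (Vert.bdry k))
    (p : Vert b) : 0 ≤ h p := by
  have hi {h : Vert b → ℝ} (hh : IsSol 0 h) (h0 : ∀ k, 0 ≤ h (Vert.bdry k)) (k : Fin 2) :
      0 ≤ h (Vert.inner [] k) := by
    have := h0 k
    have := h0 k.rev
    rw [hh.inner_nil]
    simp only [innerVals, Pi.zero_apply, sub_zero]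
    positivity
  rcases p with k | ⟨w, k⟩
  · exact h0 k
  · induction w generalizing h with
    | nil => exact hi hh h0 k
    | cons i w ih =>
      have := ih (((isSol_iff 0 h).1 hh).2 i) fun k => ?_
      · simpa only [Function.comp, cellMap_inner] using this
      · rw [Function.comp_apply, apply_cellMap_bdry h]
        rcases i with i | m
        · exact hi hh h0 k
        · simp only [cellData]
          split_ifs
          exacts [h0 k, hi hh h0 m]

variable [NeZero b]

theorem tendsto_graphForm {f g : Vert b → ℝ} (hf : FiniteEnergy f) (hg : FiniteEnergy g) :
    Tendsto (fun l : ℕ => graphForm l f g) atTop (𝓝 (energyForm f g)) := by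
  simp only [graphForm_eq]
  exact ((hf.add_sub hg).1.tendsto.sub (hf.add_sub hg).2.tendsto).const_mul _

theorem energyForm_self {f : Vert b → ℝ} (hf : FiniteEnergy f) : energyForm f f = energy f := by
  refine tendsto_nhds_unique (tendsto_graphForm hf hf) ?_
  simpa only [graphForm_self] using hf.tendsto

theorem energyForm_sub_left {f f' g : Vert b → ℝ} (hf : FiniteEnergy f) (hf' : FiniteEnergy f')
    (hg : FiniteEnergy g) : energyForm (f - f') g = energyForm f g - energyForm f' g := by
  refine tendsto_nhds_unique (tendsto_graphForm (hf.add_sub hf').2 hg) ?_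
  refine ((tendsto_graphForm hf hg).sub (tendsto_graphForm hf' hg)).congr fun l => ?_
  simp only [graphForm, Finset.mul_sum, ← Finset.sum_sub_distrib]
  refine Finset.sum_congr rfl fun w _ => ?_
  simp only [Pi.sub_apply]
  ring

/-! ### Harmonic functions -/

/-- The same current `r (h(q₁) - h(q₂))` flows through the first edge, through the `b` parallel
edges together and through the last edge. The sum against the increments of `g` therefore
telescopes, and the factor `r` cancels the renormalization. -/
theorem IsSol.graphForm_harmonic {h : Vert b → ℝ} (hh : IsSol 0 h) (l : ℕ) (g : Vert b → ℝ) :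
    graphForm l h g =
      (h (Vert.bdry 0) - h (Vert.bdry 1)) * (g (Vert.bdry 0) - g (Vert.bdry 1)) := by
  induction l generalizing h g with
  | zero => exact graphForm_zero h g
  | succ l ih =>
    have hr := ren_pos b
    rw [graphForm_succ, Finset.sum_congr rfl fun i _ => ih (((isSol_iff 0 h).1 hh).2 i) _,
      inv_mul_eq_iff_eq_mul₀ hr.ne']
    have hb : (2 * b + 1 : ℝ) ≠ 0 := by positivity
    have e0 := hh.inner_nil 0
    have e1 := hh.inner_nil 1
    simp only [innerVals, Pi.zero_apply, sub_zero, show (0 : Fin 2).rev = 1 from rfl,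
      show (1 : Fin 2).rev = 0 from rfl] at e0 e1
    simp only [Function.comp, Fintype.sum_sum_type, cellMap, Fin.sum_univ_two,
      Finset.sum_const, Finset.card_univ, Fintype.card_fin, nsmul_eq_mul, if_true, if_false,
      zero_ne_one, one_ne_zero, e0, e1, ren]
    field_simp
    ring

/-- The harmonic function with boundary values `1` at the boundary point with index `k`, and `0` at
the other one. -/
noncomputable def tent (b : ℕ) [NeZero b] (k : Fin 2) : Fractal b → ℝ :=
  extendK (sol 0 (Pi.single k 1))

theorem finiteEnergy_tent (k : Fin 2) : FiniteEnergy (sol (b := b) 0 (Pi.single k 1)) :=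
  FiniteEnergy.of_graphForm fun l => ((isSol_sol _ _).graphForm_harmonic l _).le

theorem continuous_tent (k : Fin 2) : Continuous (tent b k) :=
  (finiteEnergy_tent k).continuous_extendK

theorem restrict_tent (k : Fin 2) : restrict (tent b k) = sol 0 (Pi.single k 1) :=
  (finiteEnergy_tent k).restrict_extendK

theorem isSol_tent (k : Fin 2) : IsSol 0 (restrict (tent b k)) := by
  rw [restrict_tent]; exact isSol_sol _ _

theorem tent_bdry (k n : Fin 2) :
    tent b k (Vert.bdry n : Vert b) = if n = k then 1 else 0 := by
  rw [show tent b k (Vert.bdry n : Vert b) = restrict (tent b k) (Vert.bdry n) from rfl,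
    restrict_tent, sol, Pi.single_apply]

theorem tent_inner (k n : Fin 2) :
    tent b k (Vert.inner [] n : Vert b) = if n = k then 1 - ren b else ren b := by
  have hb : (2 * b + 1 : ℝ) ≠ 0 := by positivity
  have := (isSol_tent (b := b) k).inner_nil n
  rw [show restrict (tent b k) (Vert.inner [] n) = tent b k (Vert.inner [] n : Vert b) from rfl]
    at this
  rw [this]
  simp only [innerVals, restrict, tent_bdry, ren]
  fin_cases k <;> fin_cases n <;> simp <;> field_simp
  all_goals ring

theorem harmonic_eq {h : Fractal b → ℝ} (hc : Continuous h) (hh : IsSol 0 (restrict h)) :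
    h = fun x => h (q b 0) * tent b 0 x + h (q b 1) * tent b 1 x := by
  have c0 := continuous_tent (b := b) 0
  have c1 := continuous_tent (b := b) 1
  refine eq_of_forall_coe hc (by fun_prop) (hh.ext ?_ fun k => ?_)
  · have := ((isSol_tent (b := b) 0).smul (h (q b 0))).add ((isSol_tent 1).smul (h (q b 1)))
    rw [smul_zero, smul_zero, add_zero] at this
    exact this
  · fin_cases k <;> simp [restrict, tent_bdry, q]

theorem tent_add_tent (x : Fractal b) : tent b 0 x + tent b 1 x = 1 := by
  have : IsSol 0 (restrict (fun _ : Fractal b => (1 : ℝ))) := fun w k => by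
    simp [restrict]
  simpa using (congrFun (harmonic_eq continuous_const this) x).symm

theorem tent_nonneg (k : Fin 2) (x : Fractal b) : 0 ≤ tent b k x := by
  induction x using UniformSpace.Completion.induction_on with
  | hp => exact isClosed_le continuous_const (continuous_tent k)
  | ih p =>
    refine (isSol_tent k).nonneg (fun n => ?_) p
    rw [restrict, tent_bdry]
    split_ifs <;> norm_num

theorem tent_comp_cellMapK (k : Fin 2) (i : Cell b) (x : Fractal b) :
    tent b k (cellMapK i x) =
      tent b k (cellMapK i (q b 0)) * tent b 0 x + tent b k (cellMapK i (q b 1)) * tent b 1 x := by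
  have h : restrict (tent b k ∘ cellMapK i) = restrict (tent b k) ∘ cellMap i := by
    funext p; simp [restrict, cellMapK_coe]
  have h1 : IsSol 0 (restrict (tent b k ∘ cellMapK i)) := by
    rw [h]; exact ((isSol_iff 0 _).1 (isSol_tent k)).2 i
  exact congrFun (harmonic_eq ((continuous_tent k).comp (continuous_cellMapK i)) h1) x

end

section

variable {b : ℕ}

/-- A bound on the average over the first-level cells. -/
theorem abs_average_le {c : Cell b → ℝ} {A : ℝ} (h : ∀ i, |c i| ≤ A) :
    |((b : ℝ) + 2)⁻¹ * ∑ i, c i| ≤ A := by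
  have hb : (0 : ℝ) < b + 2 := by positivity
  rw [abs_mul, abs_of_pos (inv_pos.2 hb), inv_mul_le_iff₀ hb]
  refine (Finset.abs_sum_le_sum_abs _ _).trans ((Finset.sum_le_sum fun i _ => h i).trans ?_)
  simp

variable [NeZero b]

/-! ### Integrals against the harmonic functions, and fluxes -/

/-- The integral of `f` against the harmonic function `tent b k`. -/
noncomputable def moment (k : Fin 2) (f : Fractal b → ℝ) : ℝ :=
  ∫ x, f x * tent b k x ∂selfSimilarMeasure b

theorem moment_add (k : Fin 2) {f g : Fractal b → ℝ} (hf : Continuous f) (hg : Continuous g) :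
    moment k (f + g) = moment k f + moment k g := by
  have := continuous_tent (b := b) k
  simp only [moment, Pi.add_apply, add_mul]
  exact integral_add (integrable_of_continuous (by fun_prop))
    (integrable_of_continuous (by fun_prop))

theorem moment_smul (k : Fin 2) (c : ℝ) (f : Fractal b → ℝ) :
    moment k (c • f) = c * moment k f := by
  simp only [moment, Pi.smul_apply, smul_eq_mul, mul_assoc, integral_const_mul]

theorem moment_zero (k : Fin 2) : moment k (0 : Fractal b → ℝ) = 0 := by simp [moment]

theorem sum_moment_mul {f : Fractal b → ℝ} (hf : Continuous f) (c : Fin 2 → ℝ) :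
    ∑ k, moment k f * c k =
      ∫ x, f x * (c 0 * tent b 0 x + c 1 * tent b 1 x) ∂selfSimilarMeasure b := by
  have h (k : Fin 2) := continuous_tent (b := b) k
  have h0 := h 0
  have h1 := h 1
  simp only [Fin.sum_univ_two, moment, ← integral_mul_const]
  rw [← integral_add (integrable_of_continuous (by fun_prop))
    (integrable_of_continuous (by fun_prop))]
  congr with x
  ring

theorem abs_convex_tent_le {c : Fin 2 → ℝ} {M : ℝ} (h : ∀ k, |c k| ≤ M) (x : Fractal b) :
    |c 0 * tent b 0 x + c 1 * tent b 1 x| ≤ M := by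
  have h0 := tent_nonneg 0 x
  have h1 := tent_nonneg 1 x
  refine (abs_add_le _ _).trans ?_
  rw [abs_mul, abs_mul, abs_of_nonneg h0, abs_of_nonneg h1]
  have h2 := mul_le_mul_of_nonneg_right (h 0) h0
  have h3 := mul_le_mul_of_nonneg_right (h 1) h1
  linear_combination h2 + h3 + M * tent_add_tent x

theorem abs_sum_moment_le {f : Fractal b → ℝ} (hf : Continuous f) {N M : ℝ}
    (hN : ∀ x, |f x| ≤ N) {c : Fin 2 → ℝ} (hc : ∀ k, |c k| ≤ M) :
    |∑ k, moment k f * c k| ≤ N * M := by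
  rw [sum_moment_mul hf]
  refine abs_integral_le fun x => ?_
  rw [abs_mul]
  exact mul_le_mul (hN x) (abs_convex_tent_le hc x) (abs_nonneg _) ((abs_nonneg _).trans (hN x))

theorem abs_moment_le {f : Fractal b → ℝ} (hf : Continuous f) {N : ℝ} (hN : ∀ x, |f x| ≤ N)
    (k : Fin 2) : |moment k f| ≤ N := by
  have := abs_sum_moment_le hf hN (c := Pi.single k 1) (M := 1) fun n => by
    rw [Pi.single_apply]; split_ifs <;> simp
  simpa [Pi.single_apply] using this

/-- Self-similarity of `μ` splits the integral over the cells, and on each cell a harmonic function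
is the combination of the two tents given by its values at the ends. -/
theorem moment_selfSimilar (k : Fin 2) {f : Fractal b → ℝ} (hf : Continuous f) :
    moment k f = ((b : ℝ) + 2)⁻¹ * ∑ i : Cell b, ∑ n, moment n (f ∘ cellMapK i) *
      tent b k (cellMapK i (q b n)) := by
  have hk := continuous_tent (b := b) k
  rw [moment, integral_selfSimilarMeasure (by fun_prop)]
  congr 1
  refine Finset.sum_congr rfl fun i _ => ?_
  rw [sum_moment_mul (hf.comp (continuous_cellMapK i))]
  congr with x
  rw [tent_comp_cellMapK]
  rfl

/-- The factor `r / (b + 2)` by which the Laplacian scales on first-level cells. -/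
noncomputable def scale (b : ℕ) : ℝ := ren b / (b + 2)

theorem scale_pos (b : ℕ) [NeZero b] : 0 < scale b := div_pos (ren_pos b) (by positivity)

theorem scale_le_half (b : ℕ) : scale b ≤ 1 / 2 := by
  rw [scale, div_le_iff₀ (by positivity)]
  linarith [ren_lt_one b, (b.cast_nonneg : (0 : ℝ) ≤ b)]

/-- The source terms of the vertex equations of a function with Laplacian `f`. -/
noncomputable def src (f : Fractal b → ℝ) (w : List (Cell b)) (k : Fin 2) : ℝ :=
  scale b ^ (w.length + 1) * (moment k.rev (f ∘ wordMapK (w ++ [Sum.inr k])) +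
    ∑ i : Fin b, moment k (f ∘ wordMapK (w ++ [Sum.inl i])))

/-- On a cell, `Δ u = f` becomes `Δ (u ∘ F_i) = scale · (f ∘ F_i)`: the energy contributes `r` and
the measure `1 / (b + 2)`. The power of `scale` in `src` is what makes the sources compatible with
this. -/
theorem src_cons (f : Fractal b → ℝ) (i : Cell b) :
    (fun w => src f (i :: w)) = src (scale b • (f ∘ cellMapK i)) := by
  funext w k
  have h (v : List (Cell b)) : (scale b • (f ∘ cellMapK i)) ∘ wordMapK v =
    scale b • (f ∘ wordMapK (i :: v)) := rfl
  simp only [src, h, moment_smul, ← Finset.mul_sum, List.length_cons, List.cons_append]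
  ring

theorem src_add {f g : Fractal b → ℝ} (hf : Continuous f) (hg : Continuous g) :
    src (f + g) = src f + src g := by
  funext w k
  have h (v : List (Cell b)) : (f + g) ∘ wordMapK v = f ∘ wordMapK v + g ∘ wordMapK v := rfl
  have hf' (v : List (Cell b)) := hf.comp (continuous_wordMapK v)
  have hg' (v : List (Cell b)) := hg.comp (continuous_wordMapK v)
  simp only [src, Pi.add_apply, h, moment_add _ (hf' _) (hg' _), Finset.sum_add_distrib]
  ring

theorem src_smul (c : ℝ) (f : Fractal b → ℝ) : src (c • f) = c • src f := by
  funext w k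
  have h (v : List (Cell b)) : (c • f) ∘ wordMapK v = c • (f ∘ wordMapK v) := rfl
  simp only [src, Pi.smul_apply, smul_eq_mul, h, moment_smul, ← Finset.mul_sum]
  ring

theorem src_zero : src (0 : Fractal b → ℝ) = 0 := by
  simpa using src_smul 0 (0 : Fractal b → ℝ)

/-- The geometric decay comes from `scale ≤ 1 / 2` and is exactly what `IsSol.abs_le` needs. -/
theorem abs_src_le {f : Fractal b → ℝ} (hf : Continuous f) {N : ℝ} (hN : ∀ x, |f x| ≤ N)
    (w : List (Cell b)) (k : Fin 2) : |src f w k| ≤ (1 / 2) ^ w.length * ((b + 1) * N) := by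
  have hs := (scale_pos b).le
  have hm (v : List (Cell b)) (n : Fin 2) : |moment n (f ∘ wordMapK v)| ≤ N :=
    abs_moment_le (hf.comp (continuous_wordMapK v)) (fun x => hN _) n
  rw [src, abs_mul, abs_of_nonneg (pow_nonneg hs _)]
  refine mul_le_mul ?_ ?_ (abs_nonneg _) (by positivity)
  · rw [pow_succ]
    calc _ ≤ scale b ^ w.length * 1 :=
          mul_le_mul_of_nonneg_left (by linarith [scale_le_half b]) (pow_nonneg hs _)
      _ ≤ _ := by rw [mul_one]; exact pow_le_pow_left₀ hs (scale_le_half b) _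
  · refine (abs_add_le _ _).trans ?_
    have h1 := (Finset.abs_sum_le_sum_abs
      (fun i : Fin b => moment k (f ∘ wordMapK (w ++ [Sum.inl i]))) Finset.univ).trans (Finset.sum_le_sum fun i _ => hm (w ++ [Sum.inl i]) k)
    simp only [Finset.sum_const, Finset.card_univ, Fintype.card_fin, nsmul_eq_mul] at h1
    linarith [hm (w ++ [Sum.inr k]) k.rev]

/-- The outward flux at the boundary point with index `k` of a function `u` with Laplacian `f`; it
is the normal derivative, see `HasLaplacian.hasNormalDeriv`. -/
noncomputable def flux (k : Fin 2) (u : Vert b → ℝ) (f : Fractal b → ℝ) : ℝ :=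
  u (Vert.bdry k) - u (Vert.bdry k.rev) + moment k f

theorem flux_add (k : Fin 2) (u v : Vert b → ℝ) {f g : Fractal b → ℝ} (hf : Continuous f)
    (hg : Continuous g) : flux k (u + v) (f + g) = flux k u f + flux k v g := by
  simp only [flux, moment_add k hf hg, Pi.add_apply]
  ring

theorem flux_smul (k : Fin 2) (c : ℝ) (u : Vert b → ℝ) (f : Fractal b → ℝ) :
    flux k (c • u) (c • f) = c * flux k u f := by
  simp only [flux, moment_smul, Pi.smul_apply, smul_eq_mul]
  ring

/-- The fluxes on the first-level cells that meet at a new vertex add up to zero. -/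
theorem flux_junction {u : Vert b → ℝ} {f : Fractal b → ℝ} (hu : IsSol (src f) u) (k : Fin 2) :
    flux k.rev (u ∘ cellMap (Sum.inr k)) (scale b • (f ∘ cellMapK (Sum.inr k))) +
      ∑ i : Fin b, flux k (u ∘ cellMap (Sum.inl i)) (scale b • (f ∘ cellMapK (Sum.inl i))) = 0 := by
  have h := hu [] k
  have e (i : Cell b) : f ∘ wordMapK ([] ++ [i]) = f ∘ cellMapK i := rfl
  simp only [src, e, wordMap, List.length_nil, zero_add, pow_one] at h
  simp only [flux, moment_smul, Finset.sum_add_distrib, ← Finset.mul_sum, Function.comp_apply,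
    cellMap, Finset.sum_const, Finset.card_univ, Fintype.card_fin, nsmul_eq_mul, Fin.rev_rev, if_true]
  rw [if_neg (by fin_cases k <;> decide)]
  linear_combination h

theorem moment_eq (k : Fin 2) {f : Fractal b → ℝ} (hf : Continuous f) :
    moment k f = ((b : ℝ) + 2)⁻¹ * (moment k (f ∘ cellMapK (Sum.inr k)) +
      (1 - ren b) * moment k.rev (f ∘ cellMapK (Sum.inr k)) +
      ((1 - ren b) * ∑ i : Fin b, moment k (f ∘ cellMapK (Sum.inl i)) +
        ren b * ∑ i : Fin b, moment k.rev (f ∘ cellMapK (Sum.inl i))) +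
      ren b * moment k (f ∘ cellMapK (Sum.inr k.rev))) := by
  rw [moment_selfSimilar k hf]
  congr 1
  simp only [Fintype.sum_sum_type, Fin.sum_univ_two, q, cellMapK_coe, cellMap]
  match k with
  | 0 | 1 =>
    simp only [show (0 : Fin 2).rev = 1 from rfl, show (1 : Fin 2).rev = 0 from rfl, if_true,
      zero_ne_one, one_ne_zero, if_false, tent_inner, tent_bdry, Finset.sum_add_distrib,
      ← Finset.sum_mul]
    ring

/-- The flux at a boundary point can be computed on the end cell there, up to the renormalization
`r`. Iterating this identifies `flux` with the limit that defines the normal derivative. -/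
theorem flux_end {u : Vert b → ℝ} {f : Fractal b → ℝ} (hf : Continuous f) (hu : IsSol (src f) u)
    (k : Fin 2) : flux k (u ∘ cellMap (Sum.inr k)) (scale b • (f ∘ cellMapK (Sum.inr k))) =
      ren b * flux k u f := by
  have e (i : Cell b) : f ∘ wordMapK ([] ++ [i]) = f ∘ cellMapK i := rfl
  have h0 := hu [] k
  have h1 := hu [] k.rev
  have hb : (0 : ℝ) < 2 * b + 1 := by positivity
  have hb2 : (0 : ℝ) < b + 2 := by positivity
  simp only [src, e, wordMap, List.length_nil, zero_add, pow_one, Fin.rev_rev] at h0 h1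
  simp only [flux, moment_smul, moment_eq k hf, cellMap, Function.comp_apply, if_true]
  rw [if_neg (by fin_cases k <;> decide)]
  generalize moment k (f ∘ cellMapK (Sum.inr k)) = A at *
  generalize moment k.rev (f ∘ cellMapK (Sum.inr k)) = A' at *
  generalize moment k (f ∘ cellMapK (Sum.inr k.rev)) = C at *
  generalize ∑ i : Fin b, moment k (f ∘ cellMapK (Sum.inl i)) = S at *
  generalize ∑ i : Fin b, moment k.rev (f ∘ cellMapK (Sum.inl i)) = S' at *
  simp only [scale, ren] at *
  -- The weights are, up to sign, the row of the inverse of the 2×2 vertex system that isolates the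
  -- new vertex next to the boundary point `k`.
  have key := congrArg₂
    (fun s t => (-(b + 1) / (2 * b + 1) : ℝ) * s - (b / (2 * b + 1) : ℝ) * t) h0 h1
  field_simp at key ⊢
  linear_combination key

/-- The discrete version of `∫ f g dμ`: the integral of `f` against the harmonic interpolation of
`g` on the cells of level `l`. -/
noncomputable def pairing : ℕ → (Fractal b → ℝ) → (Vert b → ℝ) → ℝ
  | 0, f, g => ∑ k, moment k f * g (Vert.bdry k)
  | l + 1, f, g => ((b : ℝ) + 2)⁻¹ * ∑ i : Cell b, pairing l (f ∘ cellMapK i) (g ∘ cellMap i)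

theorem pairing_smul (l : ℕ) (c : ℝ) (f : Fractal b → ℝ) (g : Vert b → ℝ) :
    pairing l (c • f) g = c * pairing l f g := by
  induction l generalizing f g with
  | zero => simp only [pairing, moment_smul, Finset.mul_sum, mul_assoc]
  | succ l ih =>
    have h (i : Cell b) : (c • f) ∘ cellMapK i = c • (f ∘ cellMapK i) := rfl
    simp only [pairing, h, ih, ← Finset.mul_sum]
    ring

theorem abs_pairing_le (l : ℕ) {f : Fractal b → ℝ} (hf : Continuous f) {g : Vert b → ℝ} {N M : ℝ}
    (hN : ∀ x, |f x| ≤ N) (hM : ∀ p, |g p| ≤ M) : |pairing l f g| ≤ N * M := by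
  induction l generalizing f g with
  | zero => exact abs_sum_moment_le hf hN fun k => hM _
  | succ l ih =>
    exact abs_average_le fun i => ih (hf.comp (continuous_cellMapK i)) (fun x => hN _) fun p => hM _

/-- `pairing l` replaces `g` on each cell of level `l` by a convex combination of its two boundary
values, which differs from `g` by at most the oscillation on the cell. -/
theorem abs_pairing_sub_le (l : ℕ) {f g : Fractal b → ℝ} (hf : Continuous f) (hg : Continuous g)
    {N ε : ℝ} (hN : ∀ x, |f x| ≤ N)
    (hε : ∀ w : List (Cell b), w.length = l → ∀ x y, |g (wordMapK w x) - g (wordMapK w y)| ≤ ε) :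
    |pairing l f (restrict g) - ∫ x, f x * g x ∂selfSimilarMeasure b| ≤ N * ε := by
  induction l generalizing f g with
  | zero =>
    have h0 := continuous_tent (b := b) 0
    have h1 := continuous_tent (b := b) 1
    rw [pairing, sum_moment_mul hf, ← integral_sub (integrable_of_continuous (by fun_prop))
      (integrable_of_continuous (by fun_prop))]
    refine abs_integral_le fun x => ?_
    rw [← mul_sub, abs_mul]
    refine mul_le_mul (hN x) ?_ (abs_nonneg _) ((abs_nonneg _).trans (hN x))
    have := abs_convex_tent_le (b := b) (c := fun k => g (q b k) - g x) (M := ε)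
      (fun k => hε [] rfl _ _) x
    refine (congrArg abs ?_).trans_le this
    change g (q b 0) * tent b 0 x + g (q b 1) * tent b 1 x - g x = _
    linear_combination g x * tent_add_tent x
  | succ l ih =>
    rw [integral_selfSimilarMeasure (by fun_prop), pairing, ← mul_sub, ← Finset.sum_sub_distrib]
    refine abs_average_le fun i => ?_
    have h : restrict g ∘ cellMap i = restrict (g ∘ cellMapK i) := by
      funext p; simp [restrict, cellMapK_coe]
    rw [h]
    exact ih (hf.comp (continuous_cellMapK i)) (hg.comp (continuous_cellMapK i)) (fun x => hN _)
      fun w hw x y => hε (i :: w) (by simp [hw]) x y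

theorem tendsto_pairing {f g : Fractal b → ℝ} (hf : Continuous f) (hg : Continuous g) :
    Tendsto (fun l : ℕ => pairing l f (restrict g)) atTop
      (𝓝 (∫ x, f x * g x ∂selfSimilarMeasure b)) := by
  obtain ⟨N, hN0, hN⟩ := exists_forall_abs_le hf
  refine Metric.tendsto_atTop.2 fun ε hε => ?_
  obtain ⟨n, hn⟩ := exists_oscillation_le hg (ε := ε / (N + 1)) (by positivity)
  refine ⟨n, fun m hm => ?_⟩
  rw [Real.dist_eq]
  refine (abs_pairing_sub_le m hf hg hN (hn m hm)).trans_lt ?_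
  rw [mul_div_assoc', div_lt_iff₀ (by linarith)]
  nlinarith

/-- Discrete Green formula, exact on every level. In the induction the formula is applied on each
cell: fluxes meeting at a new vertex cancel by `flux_junction`, those at the boundary recombine by
`flux_end`, and the volume terms match because `scale = r / (b + 2)`. -/
theorem IsSol.graphForm_eq {u : Vert b → ℝ} {f : Fractal b → ℝ} (hf : Continuous f)
    (hu : IsSol (src f) u) (l : ℕ) (g : Vert b → ℝ) :
    graphForm l u g = ∑ k, flux k u f * g (Vert.bdry k) - pairing l f g := by
  induction l generalizing u f g with
  | zero =>
    simp only [graphForm_zero, pairing, flux, Fin.sum_univ_two,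
      show (0 : Fin 2).rev = 1 from rfl, show (1 : Fin 2).rev = 0 from rfl]
    ring
  | succ l ih =>
    have hr := ren_pos b
    have hi (i : Cell b) : IsSol (src (scale b • (f ∘ cellMapK i))) (u ∘ cellMap i) :=
      src_cons f i ▸ ((isSol_iff _ _).1 hu).2 i
    have hc (i : Cell b) : Continuous (scale b • (f ∘ cellMapK i)) :=
      (hf.comp (continuous_cellMapK i)).const_smul _
    rw [graphForm_succ, Finset.sum_congr rfl fun i _ => ih (hc i) (hi i) _,
      inv_mul_eq_iff_eq_mul₀ hr.ne']
    have j0 := flux_junction hu 0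
    have j1 := flux_junction hu 1
    have e0 := flux_end hf hu 0
    have e1 := flux_end hf hu 1
    simp only [show (0 : Fin 2).rev = 1 from rfl, show (1 : Fin 2).rev = 0 from rfl] at j0 j1
    have hs : ren b * ((b : ℝ) + 2)⁻¹ = scale b := rfl
    simp only [pairing, pairing_smul, Finset.sum_sub_distrib, ← Finset.mul_sum]
    generalize ∑ i : Cell b, pairing l (f ∘ cellMapK i) (g ∘ cellMap i) = T
    simp only [Fintype.sum_sum_type, Fin.sum_univ_two, Function.comp_apply,
      cellMap, Finset.sum_add_distrib, ← Finset.sum_mul, if_true, if_false, zero_ne_one,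
      one_ne_zero]
    linear_combination g (Vert.inner [] 0) * j0 + g (Vert.inner [] 1) * j1 +
      g (Vert.bdry 0) * e0 + g (Vert.bdry 1) * e1 +
      T * hs

end

section

variable {b : ℕ}

theorem wordMap_replicate (k : Fin 2) (n : ℕ) :
    wordMap (List.replicate n (Sum.inr k : Cell b)) (Vert.bdry k) = Vert.bdry k := by
  induction n with
  | zero => rfl
  | succ n ih => simp [List.replicate_succ, wordMap, ih, cellMap]

theorem exists_wordMap_bdry (p : Vert b) : ∃ w k, wordMap w (Vert.bdry k) = p := by
  rcases p with k | ⟨w, k⟩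
  · exact ⟨[], k, rfl⟩
  · refine ⟨w ++ [Sum.inr k], k.rev, ?_⟩
    fin_cases k <;> simp [wordMap_append, wordMap, cellMap, wordMap_inner]

variable [NeZero b]

/-! ### The Laplacian in terms of the vertex equations -/

/-- Green's formula with `g = u` bounds all graph energies, because `u` and `f` are bounded. -/
theorem IsSol.finiteEnergy {u : Vert b → ℝ} {f : Fractal b → ℝ} (hf : Continuous f)
    (hu : IsSol (src f) u) : FiniteEnergy u := by
  obtain ⟨N, hN0, hN⟩ := exists_forall_abs_le hf
  obtain ⟨M, hM⟩ : ∃ M, ∀ p, |u p| ≤ M := ⟨_, hu.abs_le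
    (M := |u (Vert.bdry 0)| + |u (Vert.bdry 1)|) (fun k => by
      have h0 := abs_nonneg (u (Vert.bdry 0))
      have h1 := abs_nonneg (u (Vert.bdry 1))
      match k with
      | 0 => linarith
      | 1 => linarith) (abs_src_le hf hN)⟩
  refine FiniteEnergy.of_graphForm (A := ∑ k, flux k u f * u (Vert.bdry k) - -(N * M)) fun l => ?_
  rw [hu.graphForm_eq hf l u]
  exact sub_le_sub_left (_root_.abs_le.1 (abs_pairing_le l hf hN hM)).1 _

/-- Green's formula. -/
theorem IsSol.energyForm_eq {u : Vert b → ℝ} {f : Fractal b → ℝ} (hf : Continuous f)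
    (hu : IsSol (src f) u) {g : Fractal b → ℝ} (hg : InDomEnergy g) :
    energyForm u (restrict g) =
      ∑ k, flux k u f * g (q b k) - ∫ x, f x * g x ∂selfSimilarMeasure b := by
  refine tendsto_nhds_unique (tendsto_graphForm (hu.finiteEnergy hf) hg.2) ?_
  refine ((tendsto_pairing hf hg.1).const_sub _).congr fun l => ?_
  rw [hu.graphForm_eq hf]
  rfl

theorem IsSol.hasLaplacian {u f : Fractal b → ℝ} (hu : Continuous u) (hf : Continuous f)
    (h : IsSol (src f) (restrict u)) : HasLaplacian u f := by
  refine ⟨⟨hu, h.finiteEnergy hf⟩, hf, fun g hg h0 h1 => ?_⟩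
  rw [h.energyForm_eq hf hg]
  simp [Fin.sum_univ_two, h0, h1]

/-- The solution of the Dirichlet problem `Δ u = f` with boundary values `x`. -/
noncomputable def solK (f : Fractal b → ℝ) (x : Fin 2 → ℝ) : Fractal b → ℝ :=
  extendK (sol (src f) x)

theorem restrict_solK {f : Fractal b → ℝ} (hf : Continuous f) (x : Fin 2 → ℝ) :
    restrict (solK f x) = sol (src f) x :=
  ((isSol_sol _ _).finiteEnergy hf).restrict_extendK

theorem hasLaplacian_solK {f : Fractal b → ℝ} (hf : Continuous f) (x : Fin 2 → ℝ) :
    HasLaplacian (solK f x) f := by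
  refine IsSol.hasLaplacian ((isSol_sol _ _).finiteEnergy hf).continuous_extendK hf ?_
  rw [restrict_solK hf]
  exact isSol_sol _ _

theorem solK_q {f : Fractal b → ℝ} (hf : Continuous f) (x : Fin 2 → ℝ) (k : Fin 2) :
    solK f x (q b k) = x k := congrFun (restrict_solK hf x) (Vert.bdry k)

theorem HasLaplacian.continuous {u f : Fractal b → ℝ} (h : HasLaplacian u f) : Continuous u := h.1.1

theorem HasLaplacian.continuous_right {u f : Fractal b → ℝ} (h : HasLaplacian u f) :
    Continuous f := h.2.1

/-- The difference vanishes on the boundary, so it is admissible as its own test function and has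
zero energy. By the resistance estimate it is then constant. -/
theorem HasLaplacian.ext {u v f : Fractal b → ℝ} (hu : HasLaplacian u f) (hv : HasLaplacian v f)
    (h : ∀ k, u (q b k) = v (q b k)) : u = v := by
  have hd : InDomEnergy (u - v) := ⟨hu.1.1.sub hv.1.1, (hu.1.2.add_sub hv.1.2).2⟩
  have h0 (k : Fin 2) : (u - v) (q b k) = 0 := by simp [h k]
  have hE : energy (restrict (u - v)) = 0 := by
    rw [← energyForm_self hd.2]
    change energyForm (restrict u - restrict v) _ = 0
    rw [energyForm_sub_left hu.1.2 hv.1.2 hd.2, hu.2.2 _ hd (h0 0) (h0 1),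
      hv.2.2 _ hd (h0 0) (h0 1), sub_self]
  refine eq_of_forall_coe hu.1.1 hv.1.1 (funext fun p => ?_)
  have h1 := (resistanceBound_resistance (Vert.bdry 0) p).2 _ hd.2
  rw [hE, mul_zero] at h1
  have h2 : restrict (u - v) (Vert.bdry 0) = 0 := h0 0
  rw [h2, zero_sub, neg_sq] at h1
  exact sub_eq_zero.1 (pow_eq_zero_iff (two_ne_zero) |>.1 (le_antisymm h1 (sq_nonneg _)))

/-- The constructed solution with the same boundary values satisfies the vertex equations, and by
uniqueness it is `u`. Linearity, localization to cells and reflection of the Laplacian can now be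
read off from the vertex equations. -/
theorem HasLaplacian.isSol {u f : Fractal b → ℝ} (h : HasLaplacian u f) :
    IsSol (src f) (restrict u) := by
  have hf := h.continuous_right
  rw [h.ext (hasLaplacian_solK hf fun k => u (q b k))
      fun k => (solK_q hf (fun k => u (q b k)) k).symm,
    restrict_solK hf]
  exact isSol_sol _ _

theorem HasLaplacian.add {u v f g : Fractal b → ℝ} (hu : HasLaplacian u f)
    (hv : HasLaplacian v g) : HasLaplacian (u + v) (f + g) := by
  have hf := hu.continuous_right
  have hg := hv.continuous_right
  refine IsSol.hasLaplacian (hu.continuous.add hv.continuous) (hf.add hg) ?_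
  rw [src_add hf hg]
  exact hu.isSol.add hv.isSol

theorem HasLaplacian.smul {u f : Fractal b → ℝ} (hu : HasLaplacian u f) (c : ℝ) :
    HasLaplacian (c • u) (c • f) := by
  refine IsSol.hasLaplacian (hu.continuous.const_smul c) (hu.continuous_right.const_smul c) ?_
  rw [src_smul]
  exact hu.isSol.smul c

theorem hasLaplacian_zero : HasLaplacian (0 : Fractal b → ℝ) 0 := by
  simpa using (hasLaplacian_solK (b := b) (f := 0) continuous_const 0).smul 0

theorem HasLaplacian.sub {u v f g : Fractal b → ℝ} (hu : HasLaplacian u f)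
    (hv : HasLaplacian v g) : HasLaplacian (u - v) (f - g) := by
  simpa [sub_eq_add_neg] using hu.add (hv.smul (-1))

theorem HasLaplacian.sum {ι : Type*} (s : Finset ι) {u f : ι → Fractal b → ℝ}
    (h : ∀ i ∈ s, HasLaplacian (u i) (f i)) : HasLaplacian (∑ i ∈ s, u i) (∑ i ∈ s, f i) := by
  classical
  induction s using Finset.induction_on with
  | empty => simpa using hasLaplacian_zero
  | insert a s ha ih =>
    rw [Finset.sum_insert ha, Finset.sum_insert ha]
    exact (h a (Finset.mem_insert_self a s)).add (ih fun i hi => h i (Finset.mem_insert_of_mem hi))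

theorem restrict_comp_cellMapK (u : Fractal b → ℝ) (i : Cell b) :
    restrict (u ∘ cellMapK i) = restrict u ∘ cellMap i := by
  funext p; simp [restrict, cellMapK_coe]

theorem HasLaplacian.comp_cellMapK {u f : Fractal b → ℝ} (h : HasLaplacian u f) (i : Cell b) :
    HasLaplacian (u ∘ cellMapK i) (scale b • (f ∘ cellMapK i)) := by
  have hi := continuous_cellMapK i
  refine IsSol.hasLaplacian (h.continuous.comp hi) ((h.continuous_right.comp hi).const_smul _) ?_
  rw [← src_cons, restrict_comp_cellMapK]
  exact ((isSol_iff _ _).1 h.isSol).2 i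

/-! ### Uniqueness of the Laplacian -/

theorem moment_const (k : Fin 2) (c : ℝ) :
    moment k (fun _ : Fractal b => c) = c * moment k (fun _ : Fractal b => 1) := by
  simp [moment, integral_const_mul]

theorem moment_one_nonneg (k : Fin 2) : 0 ≤ moment k (fun _ : Fractal b => 1) := by
  simpa [moment] using integral_nonneg (μ := selfSimilarMeasure b) (tent_nonneg k)

theorem moment_one_add (b : ℕ) [NeZero b] :
    moment 0 (fun _ : Fractal b => 1) + moment 1 (fun _ : Fractal b => 1) = 1 := by
  have h0 := continuous_tent (b := b) 0
  have h1 := continuous_tent (b := b) 1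
  simp only [moment, one_mul]
  rw [← integral_add (integrable_of_continuous h0) (integrable_of_continuous h1)]
  simp [tent_add_tent]

theorem abs_moment_sub_le {f : Fractal b → ℝ} (hf : Continuous f) {c ε : ℝ}
    (h : ∀ x, |f x - c| ≤ ε) (k : Fin 2) :
    |moment k f - c * moment k (fun _ : Fractal b => 1)| ≤ ε := by
  have hc : Continuous fun x => f x - c := hf.sub continuous_const
  have h1 := abs_moment_le hc h k
  have h2 := moment_add k hc (continuous_const (y := c))
  have h3 : (fun x => f x - c) + (fun _ => c) = f := by funext x; simp
  rw [h3, moment_const] at h2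
  rwa [h2, add_sub_cancel_right]

/-- Zooming in at a vertex, `f` is nearly a constant `c` on small cells, and a source term there is
a positive factor times nearly `c` times a number that is at least 1. So `c = 0` at every vertex,
and the vertices are dense. -/
theorem eq_zero_of_src_eq_zero {f : Fractal b → ℝ} (hf : Continuous f) (h : src f = 0) : f = 0 := by
  refine eq_of_forall_coe hf continuous_const (funext fun p => ?_)
  obtain ⟨w, k, rfl⟩ := exists_wordMap_bdry p
  set c := restrict f (wordMap w (Vert.bdry k)) with hc
  change c = 0
  have hb1 : (1 : ℝ) ≤ b := by exact_mod_cast Nat.one_le_iff_ne_zero.2 (NeZero.ne b)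
  have key : ∀ ε > 0, |c| ≤ (b + 1) * ε := by
    intro ε hε
    obtain ⟨n, hn⟩ := exists_oscillation_le hf hε
    -- Appending end cells at `q_k` keeps the vertex as the boundary point `k` of the cell while the
    -- cell shrinks.
    set v := w ++ List.replicate n (Sum.inr k : Cell b) with hv
    have hq : c = f (wordMapK v (q b k)) := by
      rw [q, wordMapK_coe, hv, wordMap_append, wordMap_replicate]; rfl
    have hosc (i : Cell b) (x : Fractal b) : |(f ∘ wordMapK (v ++ [i])) x - c| ≤ ε := by
      rw [hq, Function.comp_apply, wordMapK_append]
      exact hn _ (by simp [hv]) v rfl _ _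
    have hm (i : Cell b) (m : Fin 2) :=
      abs_moment_sub_le (hf.comp (continuous_wordMapK _)) (hosc i) m
    have hs : src f v k = 0 := by rw [h]; rfl
    rw [src, mul_eq_zero, or_iff_right (pow_pos (scale_pos b) _).ne'] at hs
    have e1 := hm (Sum.inr k) k.rev
    have e2 := (Finset.abs_sum_le_sum_abs (fun i : Fin b =>
      moment k (f ∘ wordMapK (v ++ [Sum.inl i])) - c * moment k (fun _ : Fractal b => 1))
      Finset.univ).trans (Finset.sum_le_sum fun i _ => hm (Sum.inl i) k)
    simp only [Finset.sum_sub_distrib, Finset.sum_const, Finset.card_univ, Fintype.card_fin,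
      nsmul_eq_mul] at e2
    set A := moment k.rev (f ∘ wordMapK (v ++ [Sum.inr k]))
    set S := ∑ i : Fin b, moment k (f ∘ wordMapK (v ++ [Sum.inl i]))
    have m0 := moment_one_nonneg (b := b) 0
    have m1 := moment_one_nonneg (b := b) 1
    have m2 := moment_one_add b
    -- The two moments of `1` are nonnegative with sum 1, and `b ≥ 1`.
    have m3 : 1 ≤ moment k.rev (fun _ : Fractal b => 1) + b * moment k (fun _ : Fractal b => 1) := by
      match k with
      | 0 | 1 =>
        simp only [show (0 : Fin 2).rev = 1 from rfl, show (1 : Fin 2).rev = 0 from rfl]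
        nlinarith
    set m := moment k.rev (fun _ : Fractal b => 1)
    set m' := moment k (fun _ : Fractal b => 1)
    have e3 : |c * (m + b * m')| ≤ (b + 1) * ε := by
      have : c * (m + b * m') = -((A - c * m) + (S - b * (c * m'))) := by linear_combination hs
      rw [this, abs_neg]
      refine (abs_add_le _ _).trans ?_
      linarith
    rw [abs_mul, abs_of_nonneg (zero_le_one.trans m3)] at e3
    nlinarith [abs_nonneg c]
  refine abs_eq_zero.1 (le_antisymm (le_of_forall_pos_le_add fun ε hε => ?_) (abs_nonneg c))
  have hb : (0 : ℝ) < b + 1 := by positivity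
  have := key (ε / (b + 1)) (by positivity)
  rw [mul_div_cancel₀ _ hb.ne'] at this
  linarith

/-- Iterated Laplacians are defined through existential witnesses; this makes the witnesses unique.
-/
theorem HasLaplacian.unique {u f g : Fractal b → ℝ} (hf : HasLaplacian u f)
    (hg : HasLaplacian u g) : f = g := by
  have h := hf.sub hg
  rw [sub_self] at h
  refine sub_eq_zero.1 (eq_zero_of_src_eq_zero h.continuous_right ?_)
  funext w k
  simpa [restrict] using h.isSol w k

/-! ### Normal derivatives -/

theorem HasLaplacian.flux_comp_replicate {u f : Fractal b → ℝ} (h : HasLaplacian u f) (k : Fin 2)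
    (m : ℕ) : flux k (restrict (u ∘ wordMapK (List.replicate m (Sum.inr k))))
      (scale b ^ m • (f ∘ wordMapK (List.replicate m (Sum.inr k)))) =
        ren b ^ m * flux k (restrict u) f := by
  induction m generalizing u f with
  | zero => simp [List.replicate, Function.comp_def, wordMapK]
  | succ m ih =>
    have h1 := ih (h.comp_cellMapK (Sum.inr k))
    rw [restrict_comp_cellMapK, flux_end h.continuous_right h.isSol] at h1
    rw [pow_succ (ren b), mul_assoc, ← h1, pow_succ, mul_smul]
    rfl

/-- By `flux_comp_replicate`, the difference quotient equals the flux minus `(b + 2)^{-m}` times a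
bounded moment. -/
theorem HasLaplacian.hasNormalDeriv {u f : Fractal b → ℝ} (h : HasLaplacian u f) (k : Fin 2) :
    HasNormalDeriv u k (flux k (restrict u) f) := by
  have hf := h.continuous_right
  obtain ⟨N, hN0, hN⟩ := exists_forall_abs_le hf
  have hr := ren_pos b
  have hb : (0 : ℝ) < b + 2 := by positivity
  set mm : ℕ → ℝ := fun m => moment k (f ∘ wordMapK (List.replicate m (Sum.inr k))) with hmm
  have heq (m : ℕ) : ((ren b) ^ m)⁻¹ * (u (q b k) - u (neighbour b k m)) =
      flux k (restrict u) f - (((b : ℝ) + 2)⁻¹) ^ m * mm m := by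
    have h1 := h.flux_comp_replicate k m
    rw [flux, moment_smul] at h1
    have h2 : restrict (u ∘ wordMapK (List.replicate m (Sum.inr k))) (Vert.bdry k) = u (q b k) := by
      simp [restrict, wordMapK_coe, wordMap_replicate, q]
    have h3 : restrict (u ∘ wordMapK (List.replicate m (Sum.inr k))) (Vert.bdry k.rev) =
        u (neighbour b k m) := by
      simp [restrict, wordMapK_coe, neighbour]
    rw [h2, h3] at h1
    rw [inv_mul_eq_iff_eq_mul₀ (pow_ne_zero m hr.ne')]
    have h4 : scale b ^ m = ren b ^ m * (((b : ℝ) + 2)⁻¹) ^ m := by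
      rw [← mul_pow]; rfl
    rw [h4] at h1
    linear_combination h1
  rw [HasNormalDeriv, funext heq]
  have hz : Tendsto (fun m => (((b : ℝ) + 2)⁻¹) ^ m * mm m) atTop (𝓝 0) := by
    have hp := (tendsto_pow_atTop_nhds_zero_of_lt_one (inv_nonneg.2 hb.le)
      (inv_lt_one_of_one_lt₀ (by linarith [(b.cast_nonneg : (0 : ℝ) ≤ b)]))).mul_const N
    rw [zero_mul] at hp
    refine squeeze_zero_norm (fun m => ?_) hp
    rw [norm_mul, norm_pow, Real.norm_of_nonneg (inv_nonneg.2 hb.le)]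
    exact mul_le_mul_of_nonneg_left
      (abs_moment_le (hf.comp (continuous_wordMapK _)) (fun x => hN _) k) (by positivity)
  simpa using hz.const_sub (flux k (restrict u) f)

theorem HasNormalDeriv.unique {u : Fractal b → ℝ} {k : Fin 2} {d d' : ℝ}
    (h : HasNormalDeriv u k d) (h' : HasNormalDeriv u k d') : d = d' := tendsto_nhds_unique h h'

theorem HasLaplacian.normalDeriv_eq {u f : Fractal b → ℝ} (h : HasLaplacian u f) (k : Fin 2) :
    normalDeriv u k = flux k (restrict u) f := (h.hasNormalDeriv k).limUnder_eq

/-- Given `f` and the value at `q₁`, the flux at `q₁` determines the value at `q₂`, which reduces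
the claim to the Dirichlet problem. -/
theorem HasLaplacian.ext_cauchy {u v f : Fractal b → ℝ} (hu : HasLaplacian u f)
    (hv : HasLaplacian v f) (h : u (q b 0) = v (q b 0))
    (hd : flux 0 (restrict u) f = flux 0 (restrict v) f) : u = v := by
  refine hu.ext hv fun k => ?_
  match k with
  | 0 => exact h
  | 1 =>
    have : u (q b 0) - u (q b 1) + moment 0 f = v (q b 0) - v (q b 1) + moment 0 f := hd
    linarith

end

section

variable {b : ℕ}

/-! ### The reflection -/

/-- The reflection of the cells. -/
def reflectCell : Cell b ≃ Cell b := Equiv.sumCongr (Equiv.refl _) Fin.revPerm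

/-- The reflection of the vertices, which exchanges the two boundary points. -/
def reflect : Vert b → Vert b
  | Vert.bdry k => Vert.bdry k.rev
  | Vert.inner w k => Vert.inner (w.map reflectCell) k.rev

theorem reflect_cellMap (i : Cell b) (p : Vert b) :
    reflect (cellMap i p) = cellMap (reflectCell i) (reflect p) := by
  rcases p with k | ⟨w, k⟩
  · rcases i with i | m
    · rfl
    · fin_cases k <;> fin_cases m <;> rfl
  · simp [cellMap_inner, reflect]

theorem reflect_wordMap (w : List (Cell b)) (p : Vert b) :
    reflect (wordMap w p) = wordMap (w.map reflectCell) (reflect p) := by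
  induction w with
  | nil => rfl
  | cons i w ih => simp [wordMap, reflect_cellMap, ih]

theorem graphEnergy_comp_reflect (l : ℕ) (f : Vert b → ℝ) :
    graphEnergy l (f ∘ reflect) = graphEnergy l f := by
  induction l generalizing f with
  | zero => rw [graphEnergy_zero, graphEnergy_zero]; exact sub_sq_comm _ _
  | succ l ih =>
    have h (i : Cell b) : (f ∘ reflect) ∘ cellMap i = (f ∘ cellMap (reflectCell i)) ∘ reflect := by
      funext p; simp [reflect_cellMap]
    simp only [graphEnergy_succ, h, ih]
    rw [reflectCell.sum_comp fun i => graphEnergy l (f ∘ cellMap i)]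

/-- The reflection permutes the edges on each level and so preserves all energies; hence it does not
increase resistances and extends to `K_b`. -/
theorem ResistanceBound.reflect {p q : Vert b} {R : ℝ} (h : ResistanceBound p q R) :
    ResistanceBound (reflect p) (reflect q) R := by
  refine ⟨h.1, fun f hf => ?_⟩
  have h1 : FiniteEnergy (f ∘ BubbleDiamond.reflect) := by
    simpa only [FiniteEnergy, graphEnergy_comp_reflect] using hf
  have h2 := h.2 _ h1
  simp only [energy, graphEnergy_comp_reflect] at h2
  exact h2

theorem IsSol.comp_reflect {s : List (Cell b) → Fin 2 → ℝ} {g : Vert b → ℝ} (h : IsSol s g) :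
    IsSol (fun w k => s (w.map reflectCell) k.rev) (g ∘ reflect) := fun w k => by
  simp only [Function.comp_apply, reflect_wordMap]
  exact h (w.map reflectCell) k.rev

variable [NeZero b]

theorem uniformContinuous_reflect : UniformContinuous (reflect : Vert b → Vert b) :=
  (LipschitzWith.of_dist_le_mul (K := 1) fun p q => by
    rw [NNReal.coe_one, one_mul]
    exact (resistanceBound_resistance p q).reflect.resistance_le).uniformContinuous

/-- The reflection of `K_b`. -/
noncomputable def reflectK : Fractal b → Fractal b := UniformSpace.Completion.map reflect

theorem reflectK_coe (p : Vert b) : reflectK (p : Fractal b) = (reflect p : Vert b) :=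
  UniformSpace.Completion.map_coe uniformContinuous_reflect p

theorem continuous_reflectK : Continuous (reflectK : Fractal b → Fractal b) :=
  UniformSpace.Completion.continuous_map

theorem reflectK_cellMapK (i : Cell b) (x : Fractal b) :
    reflectK (cellMapK i x) = cellMapK (reflectCell i) (reflectK x) := by
  induction x using UniformSpace.Completion.induction_on with
  | hp =>
    exact isClosed_eq (continuous_reflectK.comp (continuous_cellMapK i))
      ((continuous_cellMapK _).comp continuous_reflectK)
  | ih p => simp only [cellMapK_coe, reflectK_coe, reflect_cellMap]

theorem reflectK_wordMapK (w : List (Cell b)) (x : Fractal b) :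
    reflectK (wordMapK w x) = wordMapK (w.map reflectCell) (reflectK x) := by
  induction w with
  | nil => rfl
  | cons i w ih => simp [wordMapK, reflectK_cellMapK, ih]

theorem reflectK_q (k : Fin 2) : reflectK (q b k) = q b k.rev := reflectK_coe _

theorem restrict_comp_reflectK (u : Fractal b → ℝ) :
    restrict (u ∘ reflectK) = restrict u ∘ reflect := by
  funext p; simp [restrict, reflectK_coe]

/-- The reflection permutes the equally weighted cells of level `l`, so the two integrals can differ
only through the oscillation inside cells. Refining gives the invariance of `μ`. -/
theorem abs_integral_reflectK_sub_le (l : ℕ) {f : Fractal b → ℝ} (hf : Continuous f) {ε : ℝ}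
    (hε : ∀ w : List (Cell b), w.length = l → ∀ x y, |f (wordMapK w x) - f (wordMapK w y)| ≤ ε) :
    |∫ x, f (reflectK x) ∂selfSimilarMeasure b - ∫ x, f x ∂selfSimilarMeasure b| ≤ ε := by
  have hr := continuous_reflectK (b := b)
  induction l generalizing f with
  | zero =>
    rw [← integral_sub (integrable_of_continuous (by fun_prop))
      (integrable_of_continuous (by fun_prop))]
    exact abs_integral_le fun x => hε [] rfl _ _
  | succ l ih =>
    rw [integral_selfSimilarMeasure (f := fun x => f (reflectK x)) (hf.comp hr),
      integral_selfSimilarMeasure hf,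
      ← reflectCell.sum_comp fun i => ∫ x, f (cellMapK i x) ∂selfSimilarMeasure b, ← mul_sub,
      ← Finset.sum_sub_distrib]
    refine abs_average_le fun i => ?_
    simp only [reflectK_cellMapK]
    exact ih (f := fun x => f (cellMapK (reflectCell i) x)) (hf.comp (continuous_cellMapK _))
      fun w hw x y => hε (reflectCell i :: w) (by simp [hw]) x y

theorem integral_comp_reflectK {f : Fractal b → ℝ} (hf : Continuous f) :
    ∫ x, f (reflectK x) ∂selfSimilarMeasure b = ∫ x, f x ∂selfSimilarMeasure b := by
  refine sub_eq_zero.1 (abs_eq_zero.1 (le_antisymm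
    (le_of_forall_pos_le_add fun ε hε => ?_) (abs_nonneg _)))
  obtain ⟨n, hn⟩ := exists_oscillation_le hf hε
  rw [zero_add]
  exact abs_integral_reflectK_sub_le n hf (hn n le_rfl)

theorem tent_reflectK (k : Fin 2) (x : Fractal b) : tent b k (reflectK x) = tent b k.rev x := by
  refine congrFun (eq_of_forall_coe ((continuous_tent k).comp continuous_reflectK)
    (continuous_tent k.rev) (((?_ : IsSol 0 _)).ext (isSol_tent _) fun n => ?_)) x
  · rw [restrict_comp_reflectK]
    exact (isSol_tent k).comp_reflect
  · rw [restrict_comp_reflectK]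
    change tent b k (Vert.bdry n.rev : Vert b) = tent b k.rev (Vert.bdry n : Vert b)
    rw [tent_bdry, tent_bdry]
    fin_cases k <;> fin_cases n <;> rfl

theorem moment_comp_reflectK (k : Fin 2) {f : Fractal b → ℝ} (hf : Continuous f) :
    moment k (f ∘ reflectK) = moment k.rev f := by
  have hk := continuous_tent (b := b) k.rev
  rw [moment, moment, ← integral_comp_reflectK (f := fun x => f x * _) (hf.mul hk)]
  simp [tent_reflectK]

theorem src_comp_reflectK {f : Fractal b → ℝ} (hf : Continuous f) :
    src (f ∘ reflectK) = fun w k => src f (w.map reflectCell) k.rev := by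
  funext w k
  have h (v : List (Cell b)) : (f ∘ reflectK) ∘ wordMapK v =
      (f ∘ wordMapK (v.map reflectCell)) ∘ reflectK := by
    funext x; simp [reflectK_wordMapK]
  have hc (v : List (Cell b)) := hf.comp (continuous_wordMapK v)
  simp only [src, h, moment_comp_reflectK _ (hc _), List.map_append, List.length_map]
  rfl

theorem HasLaplacian.comp_reflectK {u f : Fractal b → ℝ} (h : HasLaplacian u f) :
    HasLaplacian (u ∘ reflectK) (f ∘ reflectK) := by
  have hf := h.continuous_right
  refine IsSol.hasLaplacian (h.continuous.comp continuous_reflectK) (hf.comp continuous_reflectK) ?_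
  rw [src_comp_reflectK hf, restrict_comp_reflectK]
  exact h.isSol.comp_reflect

theorem flux_comp_reflectK (k : Fin 2) (u : Fractal b → ℝ) {f : Fractal b → ℝ}
    (hf : Continuous f) :
    flux k (restrict (u ∘ reflectK)) (f ∘ reflectK) = flux k.rev (restrict u) f := by
  rw [flux, flux, moment_comp_reflectK k hf, restrict_comp_reflectK]
  rfl

/-- The moments of `1` at the two ends agree by reflection and add up to `μ(K_b) = 1`. This is the
source of `α_1 = 1/2`. -/
theorem moment_one (k : Fin 2) : moment k (fun _ : Fractal b => 1) = 1 / 2 := by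
  have h1 := moment_one_add b
  have h2 := moment_comp_reflectK (b := b) 0 (f := fun _ => 1) continuous_const
  have h3 : moment 0 (fun _ : Fractal b => 1) = moment 1 (fun _ : Fractal b => 1) := h2
  match k with
  | 0 | 1 => linarith

end

section

variable {b : ℕ} [NeZero b]

/-! ### Towers of functions under the Laplacian -/

/-- The sequence `0, v₀, v₁, …`. -/
def lap (v : ℕ → Fractal b → ℝ) : ℕ → Fractal b → ℝ
  | 0 => 0
  | m + 1 => v m

/-- A sequence with `Δ v₀ = 0` and `Δ v_{m+1} = v_m`. -/
def Tower (v : ℕ → Fractal b → ℝ) : Prop := ∀ m, HasLaplacian (v m) (lap v m)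

/-- The generating function of the values of a tower at a point. -/
noncomputable def series (v : ℕ → Fractal b → ℝ) (x : Fractal b) : PowerSeries ℝ :=
  PowerSeries.mk fun m => v m x

/-- The generating function of the normal derivatives of a tower at a boundary point. -/
noncomputable def fluxSeries (k : Fin 2) (v : ℕ → Fractal b → ℝ) : PowerSeries ℝ :=
  PowerSeries.mk fun m => flux k (restrict (v m)) (lap v m)

/-- Multiplication of a tower by a power series. -/
noncomputable def conv (S : PowerSeries ℝ) (v : ℕ → Fractal b → ℝ) (m : ℕ) : Fractal b → ℝ :=
  ∑ p ∈ Finset.HasAntidiagonal.antidiagonal m, PowerSeries.coeff p.1 S • v p.2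

/-- The shift only drops the term in which `lap v` is taken at index 0, where it vanishes. Thus the
product of a power series and a tower is again a tower. -/
theorem lap_conv (S : PowerSeries ℝ) (v : ℕ → Fractal b → ℝ) (m : ℕ) :
    lap (conv S v) m = conv S (lap v) m := by
  cases m with
  | zero => simp [lap, conv]
  | succ m => simp [lap, conv, Finset.Nat.sum_antidiagonal_succ']

theorem lap_add (v w : ℕ → Fractal b → ℝ) (m : ℕ) : lap (v + w) m = lap v m + lap w m := by
  cases m <;> simp [lap]

namespace Tower

variable {v w : ℕ → Fractal b → ℝ}

theorem add (hv : Tower v) (hw : Tower w) : Tower (v + w) := fun m => by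
  rw [lap_add]; exact (hv m).add (hw m)

theorem conv (hv : Tower v) (S : PowerSeries ℝ) : Tower (conv S v) := fun m => by
  rw [lap_conv]
  exact HasLaplacian.sum _ fun p _ => (hv p.2).smul _

end Tower

theorem series_add (v w : ℕ → Fractal b → ℝ) (x : Fractal b) :
    series (v + w) x = series v x + series w x := by ext m; simp [series]

theorem series_conv (S : PowerSeries ℝ) (v : ℕ → Fractal b → ℝ) (x : Fractal b) :
    series (conv S v) x = S * series v x := by
  ext m
  simp [series, conv, PowerSeries.coeff_mul, Finset.sum_apply]

theorem Tower.fluxSeries_add {v w : ℕ → Fractal b → ℝ} (hv : Tower v) (hw : Tower w) (k : Fin 2) :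
    fluxSeries k (v + w) = fluxSeries k v + fluxSeries k w := by
  ext m
  simp only [fluxSeries, PowerSeries.coeff_mk, map_add, lap_add]
  exact flux_add k _ _ (hv m).continuous_right (hw m).continuous_right

theorem flux_sum {ι : Type*} (s : Finset ι) (k : Fin 2) {u f : ι → Fractal b → ℝ}
    (h : ∀ i ∈ s, Continuous (f i)) :
    flux k (restrict (∑ i ∈ s, u i)) (∑ i ∈ s, f i) = ∑ i ∈ s, flux k (restrict (u i)) (f i) := by
  classical
  induction s using Finset.induction_on with
  | empty => simp [flux, restrict, moment_zero]
  | insert a s ha ih =>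
    rw [Finset.sum_insert ha, Finset.sum_insert ha, Finset.sum_insert ha,
      ← ih fun i hi => h i (Finset.mem_insert_of_mem hi)]
    refine flux_add k _ _ (h a (Finset.mem_insert_self a s)) ?_
    rw [Finset.sum_fn]
    exact continuous_finsetSum _ fun i hi => h i (Finset.mem_insert_of_mem hi)

theorem Tower.fluxSeries_conv {v : ℕ → Fractal b → ℝ} (hv : Tower v) (S : PowerSeries ℝ)
    (k : Fin 2) : fluxSeries k (BubbleDiamond.conv S v) = S * fluxSeries k v := by
  ext m
  simp only [fluxSeries, PowerSeries.coeff_mk, PowerSeries.coeff_mul, lap_conv]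
  rw [BubbleDiamond.conv, BubbleDiamond.conv,
    flux_sum _ _ fun p _ => ((hv p.2).continuous_right.const_smul _)]
  exact Finset.sum_congr rfl fun p _ => flux_smul _ _ _ _

/-- Towers are determined by their Cauchy data at `q₁`. -/
theorem Tower.ext_cauchy {v w : ℕ → Fractal b → ℝ} (hv : Tower v) (hw : Tower w)
    (h : series v (q b 0) = series w (q b 0)) (hd : fluxSeries 0 v = fluxSeries 0 w) : v = w := by
  have h' (m : ℕ) : v m (q b 0) = w m (q b 0) := by
    simpa [series] using congrArg (PowerSeries.coeff m) h
  have hd' (m : ℕ) : flux 0 (restrict (v m)) (lap v m) = flux 0 (restrict (w m)) (lap w m) := by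
    simpa [fluxSeries] using congrArg (PowerSeries.coeff m) hd
  funext m
  have key (hl : lap v m = lap w m) : v m = w m :=
    (hl ▸ hv m).ext_cauchy (hw m) (h' m) (hl ▸ hd' m)
  induction m with
  | zero => exact key rfl
  | succ m ih =>
    have hm : v m = w m := ih fun hl => (hl ▸ hv m).ext_cauchy (hw m) (h' m) (hl ▸ hd' m)
    exact key hm

/-- Towers are determined by their boundary values. -/
theorem Tower.ext {v w : ℕ → Fractal b → ℝ} (hv : Tower v) (hw : Tower w)
    (h : ∀ k, series v (q b k) = series w (q b k)) : v = w := by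
  have h' (m : ℕ) (k : Fin 2) : v m (q b k) = w m (q b k) := by
    simpa [series] using congrArg (PowerSeries.coeff m) (h k)
  funext m
  induction m with
  | zero => exact (hv 0).ext (hw 0) (h' 0)
  | succ m ih =>
    have h1 : HasLaplacian (v (m + 1)) (w m) := ih ▸ hv (m + 1)
    exact h1.ext (hw (m + 1)) (h' _)

/-- The tower of monomials with index `k`. -/
noncomputable def monoTower (b : ℕ) [NeZero b] (k : Fin 2) : ℕ → Fractal b → ℝ
  -- For a harmonic function the flux at `q₁` is `u(q₁) - u(q₂)`, so these boundary values give the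
  -- Cauchy data `(1, 0)` and `(0, 1)`.
  | 0 => solK 0 ![if k = 0 then 1 else 0, if k = 0 then 1 else -1]
  -- The value at `q₂` is chosen to cancel the moment in the flux at `q₁`, so both Cauchy data
  -- vanish.
  | m + 1 => solK (monoTower b k m) ![0, moment 0 (monoTower b k m)]

/-- The tower of multiharmonic functions with index `k`. -/
noncomputable def dirichletTower (b : ℕ) [NeZero b] (k : Fin 2) : ℕ → Fractal b → ℝ
  | 0 => solK 0 (Pi.single k 1)
  | m + 1 => solK (dirichletTower b k m) 0

theorem tower_monoTower (k : Fin 2) : Tower (monoTower b k) := by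
  intro m
  induction m with
  | zero => exact hasLaplacian_solK continuous_const _
  | succ m ih => exact hasLaplacian_solK ih.continuous _

theorem tower_dirichletTower (k : Fin 2) : Tower (dirichletTower b k) := by
  intro m
  induction m with
  | zero => exact hasLaplacian_solK continuous_const _
  | succ m ih => exact hasLaplacian_solK ih.continuous _

theorem monoTower_q (k : Fin 2) (m : ℕ) :
    monoTower b k m (q b 0) = if m = 0 ∧ k = 0 then 1 else 0 := by
  cases m with
  | zero => rw [monoTower, solK_q (f := 0) continuous_zero]; simp
  | succ m => rw [monoTower, solK_q (tower_monoTower k m).continuous]; simp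

theorem flux_monoTower (k : Fin 2) (m : ℕ) :
    flux 0 (restrict (monoTower b k m)) (lap (monoTower b k) m) =
      if m = 0 ∧ k = 1 then 1 else 0 := by
  change monoTower b k m (q b 0) - monoTower b k m (q b 1) + _ = _
  cases m with
  | zero =>
    rw [monoTower, solK_q (f := 0) continuous_zero, solK_q (f := 0) continuous_zero]
    fin_cases k <;> simp [lap, moment_zero]
  | succ m =>
    rw [monoTower, solK_q (tower_monoTower k m).continuous,
      solK_q (tower_monoTower k m).continuous]
    simp [lap]

theorem dirichletTower_q (k n : Fin 2) (m : ℕ) :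
    dirichletTower b k m (q b n) = if m = 0 ∧ n = k then 1 else 0 := by
  cases m with
  | zero => rw [dirichletTower, solK_q (f := 0) continuous_zero]; simp [Pi.single_apply]
  | succ m => rw [dirichletTower, solK_q (tower_dirichletTower k m).continuous]; simp

theorem series_monoTower (k : Fin 2) :
    series (monoTower b k) (q b 0) = if k = 0 then 1 else 0 := by
  ext m
  rw [series, PowerSeries.coeff_mk, monoTower_q]
  split_ifs <;> simp_all [PowerSeries.coeff_one]

theorem fluxSeries_monoTower (k : Fin 2) :
    fluxSeries 0 (monoTower b k) = if k = 1 then 1 else 0 := by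
  ext m
  rw [fluxSeries, PowerSeries.coeff_mk, flux_monoTower]
  split_ifs <;> simp_all [PowerSeries.coeff_one]

theorem series_dirichletTower (k n : Fin 2) :
    series (dirichletTower b k) (q b n) = if n = k then 1 else 0 := by
  ext m
  rw [series, PowerSeries.coeff_mk, dirichletTower_q]
  split_ifs <;> simp_all [PowerSeries.coeff_one]

/-! ### Transfer of Cauchy data -/

/-- The generating function of `α`. -/
noncomputable def alphaSeries (b : ℕ) [NeZero b] : PowerSeries ℝ := series (monoTower b 0) (q b 1)

/-- The generating function of `β`. -/
noncomputable def betaSeries (b : ℕ) [NeZero b] : PowerSeries ℝ := series (monoTower b 1) (q b 1)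

/-- The generating function of `η`. -/
noncomputable def etaSeries (b : ℕ) [NeZero b] : PowerSeries ℝ := fluxSeries 1 (monoTower b 0)

/-- The generating function of `γ`. -/
noncomputable def gammaSeries (b : ℕ) [NeZero b] : PowerSeries ℝ := fluxSeries 1 (monoTower b 1)

/-- The two monomial towers are a basis of the module of towers, dual to the Cauchy data at `q₁`.
Evaluating at `q₂` yields the transfer matrix. -/
theorem Tower.eq_conv_monoTower {v : ℕ → Fractal b → ℝ} (hv : Tower v) :
    v = BubbleDiamond.conv (series v (q b 0)) (monoTower b 0) +
      BubbleDiamond.conv (fluxSeries 0 v) (monoTower b 1) := by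
  have h0 := tower_monoTower (b := b) 0
  have h1 := tower_monoTower (b := b) 1
  refine hv.ext_cauchy ((h0.conv _).add (h1.conv _)) ?_ ?_
  · simp [series_add, series_conv, series_monoTower]
  · simp [(h0.conv _).fluxSeries_add (h1.conv _), h0.fluxSeries_conv, h1.fluxSeries_conv,
      fluxSeries_monoTower]

theorem Tower.transfer_value {v : ℕ → Fractal b → ℝ} (hv : Tower v) :
    series v (q b 1) = alphaSeries b * series v (q b 0) + betaSeries b * fluxSeries 0 v := by
  conv_lhs => rw [hv.eq_conv_monoTower]
  rw [series_add, series_conv, series_conv, alphaSeries, betaSeries]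
  ring

theorem Tower.transfer_flux {v : ℕ → Fractal b → ℝ} (hv : Tower v) :
    fluxSeries 1 v = etaSeries b * series v (q b 0) + gammaSeries b * fluxSeries 0 v := by
  have h0 := tower_monoTower (b := b) 0
  have h1 := tower_monoTower (b := b) 1
  conv_lhs => rw [hv.eq_conv_monoTower]
  rw [(h0.conv _).fluxSeries_add (h1.conv _), h0.fluxSeries_conv, h1.fluxSeries_conv, etaSeries,
    gammaSeries]
  ring

/-! ### Consequences of the reflection -/

theorem Tower.comp_reflectK {v : ℕ → Fractal b → ℝ} (hv : Tower v) :
    Tower fun m => v m ∘ reflectK := fun m => by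
  have := (hv m).comp_reflectK
  cases m <;> exact this

theorem series_comp_reflectK (v : ℕ → Fractal b → ℝ) (k : Fin 2) :
    series (fun m => v m ∘ reflectK) (q b k) = series v (q b k.rev) := by
  ext m; simp [series, reflectK_q]

theorem Tower.fluxSeries_comp_reflectK {v : ℕ → Fractal b → ℝ} (hv : Tower v) (k : Fin 2) :
    fluxSeries k (fun m => v m ∘ reflectK) = fluxSeries k.rev v := by
  ext m
  rw [fluxSeries, fluxSeries, PowerSeries.coeff_mk, PowerSeries.coeff_mk,
    ← flux_comp_reflectK k _ (hv m).continuous_right]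
  cases m <;> rfl

/-- The reflected first monomial tower has Cauchy data `(α, η)` at `q₁` and value `1` at `q₂`;
transferring gives `1 = α² + βη`. -/
theorem betaSeries_mul_etaSeries (b : ℕ) [NeZero b] :
    betaSeries b * etaSeries b = 1 - alphaSeries b ^ 2 := by
  have h0 := tower_monoTower (b := b) 0
  have h := h0.comp_reflectK.transfer_value
  rw [series_comp_reflectK, series_comp_reflectK, h0.fluxSeries_comp_reflectK] at h
  simp only [show (0 : Fin 2).rev = 1 from rfl, show (1 : Fin 2).rev = 0 from rfl,
    series_monoTower, if_true] at h
  change 1 = alphaSeries b * alphaSeries b + betaSeries b * etaSeries b at h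
  linear_combination -h

theorem betaSeries_ne_zero (b : ℕ) [NeZero b] : betaSeries b ≠ 0 := by
  intro h
  have := congrArg (PowerSeries.coeff 0) h
  rw [betaSeries, series, PowerSeries.coeff_mk, monoTower, solK_q (f := 0) continuous_zero] at this
  simp at this

/-- The reflected second monomial tower gives `0 = αβ + βγ`, and `β` can be cancelled because its
constant term is `-1`. -/
theorem gammaSeries_eq (b : ℕ) [NeZero b] : gammaSeries b = - alphaSeries b := by
  have h1 := tower_monoTower (b := b) 1
  have h := h1.comp_reflectK.transfer_value
  rw [series_comp_reflectK, series_comp_reflectK, h1.fluxSeries_comp_reflectK] at h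
  simp only [show (0 : Fin 2).rev = 1 from rfl, show (1 : Fin 2).rev = 0 from rfl,
    series_monoTower, one_ne_zero, if_false] at h
  change 0 = alphaSeries b * betaSeries b + betaSeries b * gammaSeries b at h
  refine mul_left_cancel₀ (betaSeries_ne_zero b) ?_
  linear_combination -h

/-! ### Self-similarity of the generating functions -/

/-- The tower that `v` induces on a first-level cell. -/
noncomputable def cellTower (i : Cell b) (v : ℕ → Fractal b → ℝ) (m : ℕ) : Fractal b → ℝ :=
  ((scale b)⁻¹ ^ m) • (v m ∘ cellMapK i)

/-- The factor `scale^{-m}` in the cell tower absorbs the `scale` that each Laplacian acquires on a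
cell. In generating functions it is the substitution `z ↦ z / scale`. -/
theorem lap_cellTower (i : Cell b) (v : ℕ → Fractal b → ℝ) (m : ℕ) :
    lap (cellTower i v) m = ((scale b)⁻¹ ^ m) • (scale b • (lap v m ∘ cellMapK i)) := by
  have hs := (scale_pos b).ne'
  cases m with
  | zero => funext x; simp [lap]
  | succ m =>
    rw [smul_smul, pow_succ, mul_assoc, inv_mul_cancel₀ hs, mul_one]
    rfl

theorem Tower.cellTower {v : ℕ → Fractal b → ℝ} (hv : Tower v) (i : Cell b) :
    Tower (cellTower i v) := fun m => by
  rw [lap_cellTower]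
  exact ((hv m).comp_cellMapK i).smul _

theorem series_cellTower (i : Cell b) (v : ℕ → Fractal b → ℝ) (x : Fractal b) :
    series (cellTower i v) x = PowerSeries.rescale (scale b)⁻¹ (series v (cellMapK i x)) := by
  ext m
  simp [series, cellTower, PowerSeries.coeff_rescale]

theorem coeff_fluxSeries_cellTower (i : Cell b) (v : ℕ → Fractal b → ℝ) (k : Fin 2) (m : ℕ) :
    PowerSeries.coeff m (fluxSeries k (cellTower i v)) = (scale b)⁻¹ ^ m *
      flux k (restrict (v m) ∘ cellMap i) (scale b • (lap v m ∘ cellMapK i)) := by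
  rw [fluxSeries, PowerSeries.coeff_mk, lap_cellTower, ← restrict_comp_cellMapK]
  exact flux_smul _ _ _ _

theorem Tower.fluxSeries_junction {v : ℕ → Fractal b → ℝ} (hv : Tower v) (k : Fin 2) :
    fluxSeries k.rev (BubbleDiamond.cellTower (Sum.inr k) v) +
      ∑ i : Fin b, fluxSeries k (BubbleDiamond.cellTower (Sum.inl i) v) = 0 := by
  ext m
  rw [map_add, map_sum]
  simp only [coeff_fluxSeries_cellTower, ← Finset.mul_sum, ← mul_add]
  rw [flux_junction (hv m).isSol k]
  simp

theorem Tower.fluxSeries_end {v : ℕ → Fractal b → ℝ} (hv : Tower v) (k : Fin 2) :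
    fluxSeries k (BubbleDiamond.cellTower (Sum.inr k) v) =
      PowerSeries.C (ren b) * PowerSeries.rescale (scale b)⁻¹ (fluxSeries k v) := by
  ext m
  rw [coeff_fluxSeries_cellTower, flux_end (hv m).continuous_right (hv m).isSol k,
    PowerSeries.coeff_C_mul, PowerSeries.coeff_rescale, fluxSeries, PowerSeries.coeff_mk]
  ring

/-- Transfer of the Cauchy data through an end cell, the middle cells and the other end cell. -/
theorem Tower.transfer_selfSimilar {v : ℕ → Fractal b → ℝ} (hv : Tower v) {x y p t : PowerSeries ℝ}
    (hx : x = PowerSeries.rescale (scale b)⁻¹ (series v (q b 0)))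
    (hy : y = PowerSeries.C (ren b) * PowerSeries.rescale (scale b)⁻¹ (fluxSeries 0 v))
    (hp : p = alphaSeries b * x + betaSeries b * y)
    (ht : t = etaSeries b * x + gammaSeries b * y) :
    (b : PowerSeries ℝ) * PowerSeries.rescale (scale b)⁻¹ (series v (q b 1)) =
      alphaSeries b * (b * alphaSeries b * p - betaSeries b * t) +
        b * betaSeries b * (gammaSeries b * t - b * etaSeries b * p) := by
  have c0 : cellMapK (Sum.inr 0 : Cell b) (q b 0) = q b 0 := cellMapK_coe _ _
  have c1 : cellMapK (Sum.inr 0 : Cell b) (q b 1) = (Vert.inner [] 0 : Vert b) := cellMapK_coe _ _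
  have c2 (i : Fin b) : cellMapK (Sum.inl i : Cell b) (q b 0) = (Vert.inner [] 0 : Vert b) :=
    cellMapK_coe _ _
  have c3 (i : Fin b) : cellMapK (Sum.inl i : Cell b) (q b 1) = (Vert.inner [] 1 : Vert b) :=
    cellMapK_coe _ _
  have c4 : cellMapK (Sum.inr 1 : Cell b) (q b 0) = (Vert.inner [] 1 : Vert b) := cellMapK_coe _ _
  have c5 : cellMapK (Sum.inr 1 : Cell b) (q b 1) = q b 1 := cellMapK_coe _ _
  have l1 := (hv.cellTower (Sum.inr 0)).transfer_value
  have l2 := (hv.cellTower (Sum.inr 0)).transfer_flux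
  -- At the first new vertex every middle cell has the same value `p`, but only the sum `-t` of the
  -- fluxes is known. Transfer is linear with the same matrix for each cell, so the sum over the
  -- middle cells suffices; this is why the conclusion carries the factor `b`.
  have m1 := Finset.sum_congr (rfl : (Finset.univ : Finset (Fin b)) = _) fun i _ =>
    (hv.cellTower (Sum.inl i)).transfer_value
  have m2 := Finset.sum_congr (rfl : (Finset.univ : Finset (Fin b)) = _) fun i _ =>
    (hv.cellTower (Sum.inl i)).transfer_flux
  have r1 := (hv.cellTower (Sum.inr 1)).transfer_value
  have j0 := hv.fluxSeries_junction 0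
  have j1 := hv.fluxSeries_junction 1
  rw [hv.fluxSeries_end, series_cellTower, series_cellTower, c0, c1, ← hx, ← hy, ← hp] at l1
  rw [hv.fluxSeries_end, series_cellTower, c0, ← hx, ← hy, ← ht] at l2
  simp only [series_cellTower, c2, c3, Finset.sum_add_distrib, ← Finset.mul_sum, Finset.sum_const,
    Finset.card_univ, Fintype.card_fin, nsmul_eq_mul, l1] at m1 m2
  rw [series_cellTower, series_cellTower, c4, c5] at r1
  simp only [show (0 : Fin 2).rev = 1 from rfl, show (1 : Fin 2).rev = 0 from rfl] at j0 j1
  rw [l2] at j0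
  linear_combination b * r1 + alphaSeries b * m1 + alphaSeries b * betaSeries b * j0 +
    b * betaSeries b * j1 - b * betaSeries b * m2 - b * betaSeries b * gammaSeries b * j0

/-- The first monomial tower has `x = 1`, `y = 0`, hence `p = α`, `t = η`. The reflection identities
eliminate `η` and `γ`, leaving an equation for `α` alone. -/
theorem rescale_alphaSeries (b : ℕ) [NeZero b] :
    (b : PowerSeries ℝ) * PowerSeries.rescale (scale b)⁻¹ (alphaSeries b) =
      alphaSeries b * (((b : PowerSeries ℝ) + 1) ^ 2 * alphaSeries b ^ 2 -
        ((b : PowerSeries ℝ) ^ 2 + b + 1)) := by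
  have h := (tower_monoTower (b := b) 0).transfer_selfSimilar rfl rfl rfl rfl
  rw [series_monoTower, fluxSeries_monoTower, ← alphaSeries] at h
  simp only [if_true, zero_ne_one, if_false, map_one, map_zero] at h
  rw [h, gammaSeries_eq]
  linear_combination (-alphaSeries b * ((b : PowerSeries ℝ) ^ 2 + b + 1)) *
    betaSeries_mul_etaSeries b

/-- Here `x = 0` and `y = r`, hence `p = rβ` and `t = rγ`; the reflection identities leave an
equation linear in `β`. -/
theorem rescale_betaSeries (b : ℕ) [NeZero b] :
    (b : PowerSeries ℝ) * PowerSeries.rescale (scale b)⁻¹ (betaSeries b) =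
      PowerSeries.C (ren b) * (betaSeries b * (((b : PowerSeries ℝ) + 1) ^ 2 * alphaSeries b ^ 2 -
        (b : PowerSeries ℝ) ^ 2)) := by
  have h := (tower_monoTower (b := b) 1).transfer_selfSimilar rfl rfl rfl rfl
  rw [series_monoTower, fluxSeries_monoTower, ← betaSeries] at h
  simp only [if_true, one_ne_zero, if_false, map_one, map_zero] at h
  rw [h, gammaSeries_eq]
  linear_combination (-PowerSeries.C (ren b) * betaSeries b * (b : PowerSeries ℝ) ^ 2) *
    betaSeries_mul_etaSeries b

end

section

variable {b : ℕ} [NeZero b]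

/-! ### Monomials and multiharmonic functions as towers -/

theorem Tower.hasIterLaplacian {v : ℕ → Fractal b → ℝ} (hv : Tower v) (n m : ℕ) :
    HasIterLaplacian m (v (n + m)) (v n) := by
  induction m with
  | zero => exact rfl
  | succ m ih => exact ⟨v (n + m), hv (n + m + 1), ih⟩

theorem Tower.hasIterLaplacian_zero {v : ℕ → Fractal b → ℝ} (hv : Tower v) (n : ℕ) :
    HasIterLaplacian (n + 1) (v n) 0 := by
  induction n with
  | zero => exact ⟨0, hv 0, rfl⟩
  | succ n ih => exact ⟨v n, hv (n + 1), ih⟩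

/-- A polynomial whose Laplacians satisfy conditions that determine the tower `v` is in `v`. -/
theorem Tower.eq_of_data {v : ℕ → Fractal b → ℝ} {Q : ℕ → (Fractal b → ℝ) → Prop}
    (hQ : ∀ n f, HasLaplacian f (lap v n) → Q n f → f = v n) (j : ℕ) {f : Fractal b → ℝ}
    (hf : IsPolynomial j f) (h : ∀ m ≤ j, ∃ g, HasIterLaplacian m f g ∧ Q (j - m) g) :
    f = v j := by
  obtain ⟨w, hw, hw'⟩ := hf
  obtain ⟨g, rfl, hg⟩ := h 0 (Nat.zero_le j)
  induction j generalizing f w with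
  | zero =>
    obtain rfl : w = 0 := hw'
    exact hQ 0 f hw hg
  | succ j ih =>
    have h' : ∀ m ≤ j, ∃ g, HasIterLaplacian m w g ∧ Q (j - m) g := fun m hm => by
      obtain ⟨g, ⟨w', hfw, hg⟩, hq⟩ := h (m + 1) (by omega)
      -- The chain witnessing that `f` is a polynomial and the one carrying the data of order `m +
      -- 1` start with the same Laplacian.
      obtain rfl := hw.unique hfw
      exact ⟨g, hg, by simpa using hq⟩
    obtain ⟨z, hz, hz'⟩ := hw'
    obtain ⟨g, rfl, hg'⟩ := h' 0 (Nat.zero_le j)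
    obtain rfl := ih h' z hz hz' hg'
    exact hQ (j + 1) f hw hg

theorem isMonomial_iff (j : ℕ) (k : Fin 2) (f : Fractal b → ℝ) :
    IsMonomial b j k f ↔ f = monoTower b k j := by
  have hv := tower_monoTower (b := b) k
  constructor
  · rintro ⟨h1, h2⟩
    refine Tower.eq_of_data (Q := fun n g => g (q b 0) = (if n = 0 ∧ k = 0 then 1 else 0) ∧
      HasNormalDeriv g 0 (if n = 0 ∧ k = 1 then 1 else 0)) (fun n g hg hq => ?_) j h1
      fun m hm => ?_
    · refine hg.ext_cauchy (hv n) (by rw [hq.1, monoTower_q]) ?_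
      rw [(hg.hasNormalDeriv 0).unique hq.2, flux_monoTower]
    · obtain ⟨g, hg, hq⟩ := h2 m hm
      have e : m = j ↔ j - m = 0 := by omega
      simp only [e] at hq
      exact ⟨g, hg, hq⟩
  · rintro rfl
    refine ⟨hv.hasIterLaplacian_zero j, fun m hm => ?_⟩
    obtain ⟨n, rfl⟩ := Nat.exists_eq_add_of_le' hm
    have e : m = n + m ↔ n = 0 := by omega
    refine ⟨_, hv.hasIterLaplacian n m, ?_, ?_⟩
    · simp only [monoTower_q, e]
    · have := (hv n).hasNormalDeriv 0
      rw [flux_monoTower] at this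
      simpa only [e] using this

theorem isMultiharmonic_iff (j : ℕ) (k : Fin 2) (f : Fractal b → ℝ) :
    IsMultiharmonic b j k f ↔ f = dirichletTower b k j := by
  have hv := tower_dirichletTower (b := b) k
  constructor
  · rintro ⟨h1, h2⟩
    refine Tower.eq_of_data (Q := fun n g => ∀ i, g (q b i) = if n = 0 ∧ i = k then 1 else 0)
      (fun n g hg hq => ?_) j h1 fun m hm => ?_
    · exact hg.ext (hv n) fun i => by rw [hq, dirichletTower_q]
    · obtain ⟨g, hg, hq⟩ := h2 m hm
      have e : m = j ↔ j - m = 0 := by omega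
      simp only [e] at hq
      exact ⟨g, hg, hq⟩
  · rintro rfl
    refine ⟨hv.hasIterLaplacian_zero j, fun m hm => ?_⟩
    obtain ⟨n, rfl⟩ := Nat.exists_eq_add_of_le' hm
    have e : m = n + m ↔ n = 0 := by omega
    exact ⟨_, hv.hasIterLaplacian n m, fun i => by simp only [dirichletTower_q, e]⟩

theorem monomial_eq (j : ℕ) (k : Fin 2) : monomial b j k = monoTower b k j :=
  (isMonomial_iff j k _).1 (Classical.epsilon_spec ⟨_, (isMonomial_iff j k _).2 rfl⟩)

theorem multiharmonic_eq (j : ℕ) (k : Fin 2) : multiharmonic b j k = dirichletTower b k j :=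
  (isMultiharmonic_iff j k _).1 (Classical.epsilon_spec ⟨_, (isMultiharmonic_iff j k _).2 rfl⟩)

theorem alpha_eq (j : ℕ) : alpha b j = PowerSeries.coeff j (alphaSeries b) := by
  rw [alpha, monomial_eq, alphaSeries, series, PowerSeries.coeff_mk]

theorem beta_eq (j : ℕ) : beta b j = PowerSeries.coeff j (betaSeries b) := by
  rw [beta, monomial_eq, betaSeries, series, PowerSeries.coeff_mk]

theorem eta_eq (j : ℕ) : eta b j = PowerSeries.coeff j (etaSeries b) := by
  rw [eta, monomial_eq, etaSeries, fluxSeries, PowerSeries.coeff_mk]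
  exact (tower_monoTower 0 j).normalDeriv_eq 1

theorem gamma_eq (j : ℕ) : gamma b j = PowerSeries.coeff j (gammaSeries b) := by
  rw [gamma, monomial_eq, gammaSeries, fluxSeries, PowerSeries.coeff_mk]
  exact (tower_monoTower 1 j).normalDeriv_eq 1

theorem hasNormalDeriv_monomial (j : ℕ) (k : Fin 2) :
    HasNormalDeriv (monomial b j k) 1 (normalDeriv (monomial b j k) 1) := by
  have h := tower_monoTower (b := b) k j
  rw [monomial_eq, h.normalDeriv_eq 1]
  exact h.hasNormalDeriv 1

/-! ### Inner products as normal derivatives of multiharmonic functions -/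

theorem dirichletTower_zero (k : Fin 2) : dirichletTower b k 0 = tent b k := by
  rw [dirichletTower, solK, src_zero, tent]

theorem innerI_eq (j : ℕ) (k n : Fin 2) : innerI b j k 0 n = moment n (dirichletTower b k j) := by
  rw [innerI, multiharmonic_eq, multiharmonic_eq, dirichletTower_zero, moment]

/-- Reflection exchanges the two Dirichlet towers, since it exchanges their boundary values, and it
preserves `μ`. So `a_l` and `b_l` do not depend on the choice of indices. -/
theorem innerI_rev (j : ℕ) (k n : Fin 2) : innerI b j k.rev 0 n.rev = innerI b j k 0 n := by
  have hv := tower_dirichletTower (b := b) k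
  have h : (fun m => dirichletTower b k m ∘ reflectK) = dirichletTower b k.rev := by
    refine hv.comp_reflectK.ext (tower_dirichletTower _) fun i => ?_
    rw [series_comp_reflectK, series_dirichletTower, series_dirichletTower]
    simp only [Fin.rev_eq_iff]
  have hj : dirichletTower b k j ∘ reflectK = dirichletTower b k.rev j := congrFun h j
  rw [innerI_eq, innerI_eq, ← hj, moment_comp_reflectK _ (hv j).continuous, Fin.rev_rev]

/-- This is the convention `a_{-1} = 1`. -/
theorem coeff_zero_fluxSeries_dirichletTower (k : Fin 2) :
    PowerSeries.coeff 0 (fluxSeries k (dirichletTower b k)) = 1 := by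
  rw [fluxSeries, PowerSeries.coeff_mk]
  change dirichletTower b k 0 (q b k) - dirichletTower b k 0 (q b k.rev) + moment k 0 = 1
  rw [dirichletTower_q, dirichletTower_q, moment_zero]
  fin_cases k <;> simp

/-- For positive degree the boundary values vanish and the flux is only the moment of the preceding
function, hence the index shift `a_{l-1}`, `b_{l-1}`. -/
theorem coeff_succ_fluxSeries_dirichletTower (k n : Fin 2) (j : ℕ) :
    PowerSeries.coeff (j + 1) (fluxSeries n (dirichletTower b k)) = innerI b j k 0 n := by
  rw [fluxSeries, PowerSeries.coeff_mk, innerI_eq]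
  change dirichletTower b k (j + 1) (q b n) - dirichletTower b k (j + 1) (q b n.rev) + _ = _
  rw [dirichletTower_q, dirichletTower_q]
  simp [lap]

/-- The Dirichlet towers form a second basis of the module of towers, dual to the boundary values.
-/
theorem Tower.fluxSeries_eq {v : ℕ → Fractal b → ℝ} (hv : Tower v) (n : Fin 2) :
    fluxSeries n v = series v (q b 0) * fluxSeries n (dirichletTower b 0) +
      series v (q b 1) * fluxSeries n (dirichletTower b 1) := by
  have h0 := tower_dirichletTower (b := b) 0
  have h1 := tower_dirichletTower (b := b) 1
  have h : v = BubbleDiamond.conv (series v (q b 0)) (dirichletTower b 0) +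
      BubbleDiamond.conv (series v (q b 1)) (dirichletTower b 1) := by
    refine hv.ext ((h0.conv _).add (h1.conv _)) fun k => ?_
    rw [series_add, series_conv, series_conv, series_dirichletTower, series_dirichletTower]
    fin_cases k <;> simp
  conv_lhs => rw [h]
  rw [(h0.conv _).fluxSeries_add (h1.conv _), h0.fluxSeries_conv, h1.fluxSeries_conv]

/-! ### The recursions -/

theorem sum_Icc_one_eq {M : Type*} [AddCommMonoid M] (f : ℕ → M) (n : ℕ) :
    ∑ l ∈ Finset.Icc 1 n, f l = ∑ l ∈ Finset.range n, f (l + 1) := by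
  rw [Finset.range_eq_Ico, Finset.sum_Ico_add' f 0 n 1]
  rfl

theorem coeff_mul_eq_sum_Icc (S T : PowerSeries ℝ) (j : ℕ) :
    PowerSeries.coeff j (S * T) = PowerSeries.coeff j S * PowerSeries.coeff 0 T +
      ∑ l ∈ Finset.Icc 1 j, PowerSeries.coeff (j - l) S * PowerSeries.coeff l T := by
  rw [mul_comm, PowerSeries.coeff_mul, Finset.Nat.sum_antidiagonal_eq_sum_range_succ
    (fun i l => PowerSeries.coeff i T * PowerSeries.coeff l S), Finset.sum_range_succ',
    sum_Icc_one_eq, add_comm]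
  simp only [mul_comm, Nat.sub_zero]

theorem inv_scale_eq (b : ℕ) [NeZero b] :
    (b : ℝ) * (scale b)⁻¹ = (b + 2) * (2 * b + 1) := by
  have hb : (b : ℝ) ≠ 0 := Nat.cast_ne_zero.2 (NeZero.ne b)
  have h1 : (2 * b + 1 : ℝ) ≠ 0 := by positivity
  have h2 : (b + 2 : ℝ) ≠ 0 := by positivity
  rw [scale, ren]
  field_simp

theorem inv_scale_pow_sub_one_pos (b : ℕ) [NeZero b] {n : ℕ} (hn : n ≠ 0) :
    0 < (scale b)⁻¹ ^ n - 1 :=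
  sub_pos.2 (one_lt_pow₀ ((one_lt_inv₀ (scale_pos b)).2 (by linarith [scale_le_half b])) hn)

theorem pow_div_eq_inv_scale_pow (b n : ℕ) [NeZero b] :
    ((b : ℝ) + 2) ^ n * (2 * (b : ℝ) + 1) ^ n / (b : ℝ) ^ n = (scale b)⁻¹ ^ n := by
  have hb : (b : ℝ) ≠ 0 := Nat.cast_ne_zero.2 (NeZero.ne b)
  rw [← mul_pow, ← div_pow, ← inv_scale_eq, mul_div_cancel_left₀ _ hb]

theorem alpha_zero (b : ℕ) [NeZero b] : alpha b 0 = 1 := by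
  rw [alpha, monomial_eq, monoTower, solK_q (f := 0) continuous_zero]; simp

theorem beta_zero (b : ℕ) [NeZero b] : beta b 0 = -1 := by
  rw [beta, monomial_eq, monoTower, solK_q (f := 0) continuous_zero]; simp

theorem monoTower_zero_zero : monoTower b 0 0 = fun _ => 1 := by
  have h := tower_monoTower (b := b) 0 0
  refine h.ext (f := 0) (IsSol.hasLaplacian continuous_const continuous_zero ?_) fun k => ?_
  · rw [src_zero]
    intro w k
    simp [restrict]
  · rw [monoTower, solK_q (f := 0) continuous_zero]
    fin_cases k <;> simp

theorem alpha_one (b : ℕ) [NeZero b] : alpha b 1 = 1 / 2 := by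
  rw [alpha, monomial_eq, monoTower, solK_q (tower_monoTower 0 0).continuous, monoTower_zero_zero]
  simp [moment_one]

theorem coeff_natCast_mul (n : ℕ) (S : PowerSeries ℝ) (j : ℕ) :
    PowerSeries.coeff j ((n : PowerSeries ℝ) * S) = n * PowerSeries.coeff j S := by
  rw [← nsmul_eq_mul, map_nsmul, nsmul_eq_mul]

theorem alpha_recursion (b : ℕ) [NeZero b] {j : ℕ} (hj : 2 ≤ j) : alpha b j =
    zeta b j * ∑ l ∈ Finset.Icc 1 (j - 1), alpha b (j - l) * (2 * alpha b l +
      ∑ i ∈ Finset.Icc 1 l, alpha b (l - i) * alpha b i) := by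
  obtain ⟨n, rfl⟩ : ∃ n, j = n + 1 := ⟨j - 1, by omega⟩
  set A := alphaSeries b with hA
  set T := ∑ l ∈ Finset.Icc 1 (n + 1 - 1), alpha b (n + 1 - l) * (2 * alpha b l +
      ∑ i ∈ Finset.Icc 1 l, alpha b (l - i) * alpha b i) with hT
  have a0 : PowerSeries.coeff 0 A = 1 := by rw [hA, ← alpha_eq, alpha_zero]
  have z0 : PowerSeries.coeff 0 (A - 1) = 0 := by rw [map_sub, a0]; simp
  have za (l : ℕ) (hl : l ≠ 0) : PowerSeries.coeff l (A - 1) = alpha b l := by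
    rw [map_sub, PowerSeries.coeff_one, if_neg hl, sub_zero, hA, alpha_eq]
  have hAA (l : ℕ) : PowerSeries.coeff l (A * (A - 1)) =
      ∑ i ∈ Finset.Icc 1 l, alpha b (l - i) * alpha b i := by
    rw [coeff_mul_eq_sum_Icc, z0, mul_zero, zero_add]
    refine Finset.sum_congr rfl fun i hi => ?_
    rw [za i (by have := (Finset.mem_Icc.1 hi).1; omega), alpha_eq (l - i)]
  have key : PowerSeries.coeff (n + 1)
      ((A - 1) * (((2 : ℕ) : PowerSeries ℝ) * (A - 1) + A * (A - 1))) = T := by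
    have e : PowerSeries.coeff 0 (((2 : ℕ) : PowerSeries ℝ) * (A - 1) + A * (A - 1)) = 0 := by
      rw [map_add, coeff_natCast_mul, z0, hAA]; simp
    rw [coeff_mul_eq_sum_Icc, e, mul_zero, zero_add,
      ← Finset.insert_Icc_right_eq_Icc_add_one (by omega),
      Finset.sum_insert (by simp), Nat.sub_self, z0, zero_mul, zero_add, hT]
    refine Finset.sum_congr rfl fun l hl => ?_
    have := Finset.mem_Icc.1 hl
    rw [za _ (by omega), map_add, coeff_natCast_mul, za l (by omega), hAA]
    norm_num
  -- This is `A³ - 3A + 2 = (A - 1)² (A + 2)`. As `A - 1` has no constant term, the coefficient of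
  -- degree `n + 1` involves only `α_l` with `l ≤ n`: the top-order part of `A³` is `3 α_{n+1}`.
  have hcube : (A - 1) * (((2 : ℕ) : PowerSeries ℝ) * (A - 1) + A * (A - 1)) = A ^ 3 -
      ((3 : ℕ) : PowerSeries ℝ) * A + ((2 : ℕ) : PowerSeries ℝ) * 1 := by
    push_cast; ring
  rw [hcube, map_add, map_sub, coeff_natCast_mul, coeff_natCast_mul, PowerSeries.coeff_one,
    if_neg (Nat.succ_ne_zero n), mul_zero, add_zero, hA, ← alpha_eq] at key
  have h := congrArg (PowerSeries.coeff (n + 1)) (rescale_alphaSeries b)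
  have e2 : alphaSeries b * (((b : PowerSeries ℝ) + 1) ^ 2 * alphaSeries b ^ 2 -
      ((b : PowerSeries ℝ) ^ 2 + b + 1)) = (((b + 1) ^ 2 : ℕ) : PowerSeries ℝ) * alphaSeries b ^ 3 -
        ((b ^ 2 + b + 1 : ℕ) : PowerSeries ℝ) * alphaSeries b := by
    push_cast; ring
  rw [e2, map_sub, coeff_natCast_mul, coeff_natCast_mul, coeff_natCast_mul,
    PowerSeries.coeff_rescale, ← alpha_eq] at h
  push_cast at h
  have hp := inv_scale_pow_sub_one_pos b (n := n) (by omega)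
  have hs := inv_scale_eq b
  have h1 : (0 : ℝ) < 2 * b + 1 := by positivity
  have h2 : (0 : ℝ) < b + 2 := by positivity
  rw [zeta, pow_div_eq_inv_scale_pow, Nat.add_sub_cancel, div_mul_eq_mul_div,
    eq_div_iff (by positivity)]
  rw [pow_succ] at h
  push_cast at key
  -- The coefficient of `α_{n+1}` collects to `3(b+1)² - (b²+b+1) = (b+2)(2b+1) = b / scale`. In
  -- degree 1 it would cancel completely, which is why `α_1` needs a separate computation.
  linear_combination h + ((b : ℝ) + 1) ^ 2 * key - (scale b)⁻¹ ^ n * alpha b (n + 1) * hs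

theorem beta_recursion (b : ℕ) [NeZero b] {j : ℕ} (hj : 1 ≤ j) : beta b j =
    iota b j * ∑ l ∈ Finset.range j, ∑ i ∈ Finset.range (j - l + 1),
      beta b l * alpha b i * alpha b (j - l - i) := by
  set T := ∑ l ∈ Finset.range j, ∑ i ∈ Finset.range (j - l + 1),
      beta b l * alpha b i * alpha b (j - l - i) with hT
  have key : PowerSeries.coeff j (betaSeries b * alphaSeries b ^ 2) = T + beta b j := by
    rw [PowerSeries.coeff_mul, Finset.Nat.sum_antidiagonal_eq_sum_range_succ
      (fun i l => PowerSeries.coeff i (betaSeries b) * PowerSeries.coeff l (alphaSeries b ^ 2)),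
      Finset.sum_range_succ, hT]
    congr 1
    · refine Finset.sum_congr rfl fun l _ => ?_
      rw [sq, PowerSeries.coeff_mul, Finset.Nat.sum_antidiagonal_eq_sum_range_succ
        (fun i l => PowerSeries.coeff i (alphaSeries b) * PowerSeries.coeff l (alphaSeries b)),
        Finset.mul_sum]
      refine Finset.sum_congr rfl fun i _ => ?_
      rw [← alpha_eq, ← alpha_eq, ← beta_eq, mul_assoc]
    -- The term `l = j`, absent from the recursion's sum, contributes `β_j α_0² = β_j`.
    · have h0 : PowerSeries.coeff 0 (alphaSeries b ^ 2) = PowerSeries.coeff 0 (alphaSeries b) ^ 2 := by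
        simp
      rw [Nat.sub_self, h0, ← alpha_eq, alpha_zero, beta_eq, one_pow, mul_one]
  have h := congrArg (PowerSeries.coeff j) (rescale_betaSeries b)
  have e2 : betaSeries b * (((b : PowerSeries ℝ) + 1) ^ 2 * alphaSeries b ^ 2 -
      (b : PowerSeries ℝ) ^ 2) = (((b + 1) ^ 2 : ℕ) : PowerSeries ℝ) *
        (betaSeries b * alphaSeries b ^ 2) - ((b ^ 2 : ℕ) : PowerSeries ℝ) * betaSeries b := by
    push_cast; ring
  rw [PowerSeries.coeff_C_mul, e2, map_sub, coeff_natCast_mul, coeff_natCast_mul, coeff_natCast_mul,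
    PowerSeries.coeff_rescale, ← beta_eq, key] at h
  push_cast at h
  have hb : (b : ℝ) ≠ 0 := Nat.cast_ne_zero.2 (NeZero.ne b)
  have hp := inv_scale_pow_sub_one_pos b (n := j) (by omega)
  have h1 : (0 : ℝ) < 2 * b + 1 := by positivity
  rw [iota, pow_div_eq_inv_scale_pow, div_mul_eq_mul_div, eq_div_iff (by positivity)]
  have hr : (2 * b + 1) * ren b = b := mul_div_cancel₀ _ h1.ne'
  refine mul_left_cancel₀ hb ?_
  -- Multiplying by `2b + 1` clears the denominator of `r`; the terms in `β_j` combine through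
  -- `(b+1)² - b² = 2b + 1`.
  linear_combination (2 * (b : ℝ) + 1) * h +
    (((b : ℝ) + 1) ^ 2 * (T + beta b j) - (b : ℝ) ^ 2 * beta b j) * hr

theorem eta_zero (b : ℕ) [NeZero b] : eta b 0 = 0 := by
  rw [eta, monomial_eq, (tower_monoTower 0 0).normalDeriv_eq 1, monoTower_zero_zero]
  simp [flux, restrict, lap, moment_zero]

theorem gamma_eq_sum (b j : ℕ) [NeZero b] (k : Fin 2) : gamma b j =
    beta b j + ∑ l ∈ Finset.Icc 1 j, beta b (j - l) * innerI b (l - 1) k 0 k := by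
  have hk (l : ℕ) : innerI b l k 0 k = innerI b l 1 0 1 := by
    match k with
    | 0 => exact innerI_rev l 1 1
    | 1 => rfl
  rw [gamma_eq, gammaSeries, (tower_monoTower 1).fluxSeries_eq, series_monoTower,
    if_neg one_ne_zero, zero_mul, zero_add, coeff_mul_eq_sum_Icc,
    coeff_zero_fluxSeries_dirichletTower, mul_one, beta_eq, betaSeries]
  congr 1
  refine Finset.sum_congr rfl fun l hl => ?_
  obtain ⟨m, rfl⟩ : ∃ m, l = m + 1 := ⟨l - 1, by have := Finset.mem_Icc.1 hl; omega⟩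
  rw [coeff_succ_fluxSeries_dirichletTower, hk, beta_eq, Nat.add_sub_cancel, betaSeries]

/-- In the Dirichlet basis the first monomial tower has boundary series `1` and `α`. The first
contributes the single term `b_{j-1}`, the second the convolution with `a_{l-1}`. -/
theorem eta_eq_sum (b : ℕ) [NeZero b] {j : ℕ} (hj : 1 ≤ j) {k n : Fin 2} (hkn : k ≠ n) : eta b j =
    innerI b (j - 1) k 0 n +
      (alpha b j + ∑ l ∈ Finset.Icc 1 j, alpha b (j - l) * innerI b (l - 1) k 0 k) := by
  have hk (l : ℕ) : innerI b l k 0 k = innerI b l 1 0 1 := by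
    match k with
    | 0 => exact innerI_rev l 1 1
    | 1 => rfl
  have hn (l : ℕ) : innerI b l k 0 n = innerI b l 0 0 1 := by
    fin_cases k <;> fin_cases n
    exacts [absurd rfl hkn, rfl, innerI_rev l 0 1, absurd rfl hkn]
  obtain ⟨i, rfl⟩ : ∃ i, j = i + 1 := ⟨j - 1, by omega⟩
  rw [eta_eq, etaSeries, (tower_monoTower 0).fluxSeries_eq, series_monoTower,
    if_pos rfl, one_mul, map_add, coeff_succ_fluxSeries_dirichletTower, coeff_mul_eq_sum_Icc,
    coeff_zero_fluxSeries_dirichletTower, mul_one, alpha_eq, alphaSeries, hn, Nat.add_sub_cancel]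
  congr 2
  refine Finset.sum_congr rfl fun l hl => ?_
  obtain ⟨m, rfl⟩ : ∃ m, l = m + 1 := ⟨l - 1, by have := Finset.mem_Icc.1 hl; omega⟩
  rw [coeff_succ_fluxSeries_dirichletTower, hk, alpha_eq, Nat.add_sub_cancel, alphaSeries]

end

end BubbleDiamond

/-! ### The theorem -/

theorem mainTheorem7 (b : ℕ) [NeZero b] :
    -- the functions `f_{jk}` and `P_{jk}` are well defined, and `∂ₙ P_{jk}(q₂)` exists
    (∀ (j : ℕ) (k : Fin 2), ∃! f, BubbleDiamond.IsMultiharmonic b j k f) ∧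
    (∀ (j : ℕ) (k : Fin 2), ∃! P, BubbleDiamond.IsMonomial b j k P) ∧
    (∀ j : ℕ, BubbleDiamond.HasNormalDeriv (BubbleDiamond.monomial b j 0) 1
      (BubbleDiamond.eta b j)) ∧
    (∀ j : ℕ, BubbleDiamond.HasNormalDeriv (BubbleDiamond.monomial b j 1) 1
      (BubbleDiamond.gamma b j)) ∧
    -- initial values
    BubbleDiamond.alpha b 0 = 1 ∧ BubbleDiamond.alpha b 1 = 1 / 2 ∧
    BubbleDiamond.beta b 0 = -1 ∧ BubbleDiamond.eta b 0 = 0 ∧ BubbleDiamond.gamma b 0 = -1 ∧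
    -- recursions
    (∀ j : ℕ, 2 ≤ j → BubbleDiamond.alpha b j =
      BubbleDiamond.zeta b j * ∑ l ∈ Finset.Icc 1 (j - 1),
        BubbleDiamond.alpha b (j - l) * (2 * BubbleDiamond.alpha b l +
          ∑ i ∈ Finset.Icc 1 l, BubbleDiamond.alpha b (l - i) * BubbleDiamond.alpha b i)) ∧
    (∀ j : ℕ, 1 ≤ j → BubbleDiamond.beta b j =
      BubbleDiamond.iota b j * ∑ l ∈ Finset.range j, ∑ i ∈ Finset.range (j - l + 1),
        BubbleDiamond.beta b l * BubbleDiamond.alpha b i * BubbleDiamond.alpha b (j - l - i)) ∧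
    -- `a_l = I(lk, 0k)` and `b_l = I(lk, 0n)` for either choice of distinct `k`, `n`; `a_{-1} = 1`
    (∀ j : ℕ, 1 ≤ j → ∀ k n : Fin 2, k ≠ n → BubbleDiamond.eta b j =
      BubbleDiamond.innerI b (j - 1) k 0 n + (BubbleDiamond.alpha b j +
        ∑ l ∈ Finset.Icc 1 j,
          BubbleDiamond.alpha b (j - l) * BubbleDiamond.innerI b (l - 1) k 0 k)) ∧
    (∀ j : ℕ, 1 ≤ j → ∀ k : Fin 2, BubbleDiamond.gamma b j =
      BubbleDiamond.beta b j + ∑ l ∈ Finset.Icc 1 j,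
        BubbleDiamond.beta b (j - l) * BubbleDiamond.innerI b (l - 1) k 0 k) := by

  refine ⟨fun j k => ⟨_, (BubbleDiamond.isMultiharmonic_iff j k _).2 rfl,
      fun f hf => (BubbleDiamond.isMultiharmonic_iff j k f).1 hf⟩,
    fun j k => ⟨_, (BubbleDiamond.isMonomial_iff j k _).2 rfl,
      fun f hf => (BubbleDiamond.isMonomial_iff j k f).1 hf⟩,
    fun j => BubbleDiamond.hasNormalDeriv_monomial j 0,
    fun j => BubbleDiamond.hasNormalDeriv_monomial j 1,
    BubbleDiamond.alpha_zero b, BubbleDiamond.alpha_one b, BubbleDiamond.beta_zero b,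
    BubbleDiamond.eta_zero b, ?_, fun j hj => BubbleDiamond.alpha_recursion b hj,
    fun j hj => BubbleDiamond.beta_recursion b hj,
    fun j hj k n hkn => BubbleDiamond.eta_eq_sum b hj hkn,
    fun j _ k => BubbleDiamond.gamma_eq_sum b j k⟩
  -- For `j = 0` the sum is empty, so `γ_0 = β_0`.
  rw [BubbleDiamond.gamma_eq_sum b 0 0, BubbleDiamond.beta_zero]
  simp
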